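/- Let $1/2\le\gamma<1$, $\alpha=1/\gamma\in(1,2]$ and $b>0$. For an index $a\ne1$, an asymmetry $\eta$ and a scale $c>0$ let $$p_a(x;\eta,c)=\frac1{2\pi}\int_{-\infty}^{\infty}e^{-i\lambda x}\exp\Big\{-c|\lambda|^{a}e^{-\frac{i\pi\eta}{2}\frac{\lambda}{|\lambda|}}\Big\}\,d\lambda$$ be the stable density whose characteristic function is the exponential under the integral. For $r>0$ with $n-1<r\le n$, $n\in\mathbb N$, the negative Riemann–Liouville derivative of order $r$ of a function $f$ on $[0,\infty)$ is $$\frac{\partial^{r}f}{\partial(-x)^{r}}(x)=\Big(-\frac{d}{dx}\Big)^{n}I^{\,n-r}f(x),\qquad I^{s}f(x)=\frac1{\Gamma(s)}\int_x^\infty f(y)(y-x)^{s-1}\,dy\ (s>0),\qquad I^0f=f,$$ where the derivatives at $x=0$ are derivatives from the right. Let $D$ be a stable subordinator of index $\gamma$ and scale $b$, that is, a Lévy process with nondecreasing paths such that $D(s)$ has characteristic function $\exp\{-bs|\lambda|^{\gamma}e^{-\frac{i\pi\gamma}{2}\frac{\lambda}{|\lambda|}}\}=\exp\{-bs(-i\lambda)^\gamma\}$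 for every $s\ge0$, and let $E_t=\inf\{x>0:D(x)>t\}$ be its hitting time process. Then the following hold. (a) $D(1)$ has the nonnegative density $g_\gamma(x)=p_\gamma(x;\gamma,b)$. For every $t>0$, $E_t$ has a nonnegative density $h(\cdot,t)$ that vanishes on $(-\infty,0)$, is given by $h(x,t)=\frac t\gamma x^{-1-1/\gamma}g_\gamma(tx^{-1/\gamma})$ for $x>0$, and is continuous on $[0,\infty)$, with $h(0,t)=\lim_{x\downarrow0}h(x,t)$. (b) For every $t>0$ the function $h(\cdot,t)$ has continuous negative Riemann–Liouville derivatives of orders $\alpha$ and $\alpha-1$ on $[0,\infty)$ (the integrals $I^{2-\alpha}h(x,t)$, $x\ge0$, converge absolutely if $\alpha<2$, and $I^{2-\alpha}h(\cdot,t)$ is $C^2$ on $[0,\infty)$), and $h$ solves the boundary value problem $$\frac{\partial h(x,t)}{\partial t}=b^{-\alpha}\frac{\partial^{\alpha}h(x,t)}{\partial(-x)^{\alpha}}\quad(x>0,\ t>0),\qquad \frac{\partial^{\alpha-1}h}{\partial(-x)^{\alpha-1}}(0,t)=0\quad(t>0).$$ (c) The boundary condition expresses the conservation of the mass $1/\alpha$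 on the positive half-line of the stable Lévy motion $Y(t)$ with density $P(x,t)=p_\alpha(x;2-\alpha,b^{-\alpha}t)$: whenever $Y$ is a Lévy process such that $Y(t)$ has characteristic function $\exp\{-b^{-\alpha}t|\lambda|^{\alpha}e^{-\frac{i\pi(2-\alpha)}{2}\frac{\lambda}{|\lambda|}}\}$ for all $t\ge0$, then for every $t>0$ the variable $Y(t)$ has the density $P(\cdot,t)$ and $\mathbb P(Y(t)>0)=1/\alpha$. Moreover, for every $t>0$, $P(\cdot,t)$ has, in the sense of (b), continuous negative Riemann–Liouville derivatives of orders $\alpha$ and $\alpha-1$ on $[0,\infty)$, $P(\cdot,t)$ and $\partial^\alpha P(\cdot,t)/\partial(-x)^\alpha$ are integrable on $(0,\infty)$, $\int_0^\infty P(x,t)\,dx=1/\alpha$, and $$\frac{d}{dt}\int_0^\infty P(x,t)\,dx=b^{-\alpha}\int_0^\infty\frac{\partial^{\alpha}P(x,t)}{\partial(-x)^{\alpha}}\,dx,\qquad \int_0^\infty\frac{\partial^{\alpha}P(x,t)}{\partial(-x)^{\alpha}}\,dx=\frac{\partial^{\alpha-1}P}{\partial(-x)^{\alpha-1}}(0,t).$$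 -/

import Mathlib

open MeasureTheory ProbabilityTheory Set Filter Topology
open scoped NNReal ENNReal

noncomputable section

/-- The function `exp (-c |l|^a exp (-(i π η / 2) l / |l|))` of the real frequency `l`, equal to `1`
at `l = 0`: the characteristic function of the stable law of index `a`, asymmetry `η` and
scale `c`. -/
def stableCharFun (a η c l : ℝ) : ℂ :=
  Complex.exp (-(((c * |l| ^ a : ℝ) : ℂ)
    * Complex.exp (-(Complex.I * ((Real.pi * η / 2 * (l / |l|) : ℝ) : ℂ)))))

/-- The stable density `p_a(x; η, c) = (2π)⁻¹ ∫ exp (-i l x) stableCharFun a η c l dl`.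
The integral is real, because `stableCharFun a η c (-l)` is the conjugate of
`stableCharFun a η c l`. -/
def stableDensity (a η c x : ℝ) : ℝ :=
  (((2 * Real.pi : ℝ) : ℂ)⁻¹ *
    ∫ l : ℝ, Complex.exp (-(Complex.I * (l : ℂ) * (x : ℂ))) * stableCharFun a η c l).re

/-- The absolutely continuous measure on the real line with density `f`. -/
def densityMeasure (f : ℝ → ℝ) : Measure ℝ :=
  volume.withDensity fun x => ENNReal.ofReal (f x)

/-- A real function of a time `s ≥ 0` is right continuous with left limits. -/
def IsCadlagPath (f : ℝ≥0 → ℝ) : Prop :=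
  ∀ s : ℝ≥0, ContinuousWithinAt f (Ici s) s ∧ ∃ y : ℝ, Tendsto f (𝓝[<] s) (𝓝 y)

/-- Real-valued Lévy processes. -/
structure IsLevyProcess {Ω : Type*} [MeasurableSpace Ω] (X : ℝ≥0 → Ω → ℝ) (μ : Measure Ω) :
    Prop where
  aemeasurable : ∀ s, AEMeasurable (X s) μ
  start_zero : ∀ᵐ ω ∂μ, X 0 ω = 0
  indep_increments : HasIndepIncrements X μ
  stationary_increments : ∀ r s : ℝ≥0, IdentDistrib (fun ω => X (r + s) ω - X r ω) (X s) μ μ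
  cadlag : ∀ᵐ ω ∂μ, IsCadlagPath fun s => X s ω

/-- A stable Lévy motion: a Lévy process `X` such that `X s` has the stable law of index `a`,
asymmetry `η` and scale `c s`. -/
structure IsStableLevyMotion {Ω : Type*} [MeasurableSpace Ω] (a η c : ℝ) (X : ℝ≥0 → Ω → ℝ)
    (μ : Measure Ω) : Prop where
  levy : IsLevyProcess X μ
  law : ∀ (s : ℝ≥0) (l : ℝ), charFun (μ.map (X s)) l = stableCharFun a η (c * s) l

/-- The stable subordinator of index `γ` and scale `b`: the stable Lévy motion with asymmetry
`η = γ`, for which `stableCharFun γ γ (b * s) l = exp (-b s (-i l)^γ)`, with nondecreasing paths. -/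
structure IsStableSubordinator {Ω : Type*} [MeasurableSpace Ω] (γ b : ℝ) (D : ℝ≥0 → Ω → ℝ)
    (μ : Measure Ω) : Prop where
  stable : IsStableLevyMotion γ γ b D μ
  mono : ∀ᵐ ω ∂μ, Monotone fun s => D s ω

/-- The hitting time (inverse) process `E_t = inf {x > 0 : D(x) > t}`. -/
def hittingTime {Ω : Type*} (D : ℝ≥0 → Ω → ℝ) (t : ℝ) (ω : Ω) : ℝ :=
  ((sInf {x : ℝ≥0 | 0 < x ∧ t < D x ω} : ℝ≥0) : ℝ)

/-- The formula `(t / γ) x^(-1 - 1/γ) g(t x^(-1/γ))`, for `x > 0`, where `g` is the stable density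
`p_γ(·; γ, b)`. -/
def inverseStableFormula (γ b x t : ℝ) : ℝ :=
  t / γ * x ^ (-1 - 1 / γ) * stableDensity γ γ b (t * x ^ (-(1 / γ)))

/-- The density `h(x,t)` of the inverse stable subordinator: it is given by the formula for `x > 0`,
by its limit from the right at the boundary point `x = 0`, and it vanishes for `x < 0`. -/
def inverseStableDensity (γ b x t : ℝ) : ℝ :=
  if 0 < x then inverseStableFormula γ b x t
  else if x = 0 then limUnder (𝓝[>] (0 : ℝ)) fun y => inverseStableFormula γ b y t
  else 0

/-- The negative (right-sided) fractional integral of order `r ≥ 0`,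
`x ↦ Γ(r)⁻¹ ∫_x^∞ f(y) (y - x)^(r-1) dy`, which for `r = 0` is the function itself. -/
def negFracIntegral (r : ℝ) (f : ℝ → ℝ) (x : ℝ) : ℝ :=
  if r = 0 then f x else (Real.Gamma r)⁻¹ * ∫ y in Ioi x, f y * (y - x) ^ (r - 1)

/-- The negative Riemann-Liouville derivative of order `r > 0` on the half-line `[0, ∞)`: with
`n - 1 < r ≤ n`, it is `(-d/dx)^n` of the negative fractional integral of order `n - r`. For `x > 0`
these are ordinary derivatives, at the boundary point `x = 0` they are derivatives from the
right. -/
def negRLDeriv (r : ℝ) (f : ℝ → ℝ) (x : ℝ) : ℝ :=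
  (-1) ^ ⌈r⌉₊ * iteratedDerivWithin ⌈r⌉₊ (negFracIntegral (⌈r⌉₊ - r) f) (Ici 0) x

/-- The negative Riemann-Liouville derivative of order `r` of `f` exists on `[0, ∞)` and is
continuous: the fractional integral of order `⌈r⌉ - r` converges absolutely at every `x ≥ 0`, and
it is `⌈r⌉` times continuously differentiable on `[0, ∞)`. -/
def HasContNegRLDeriv (r : ℝ) (f : ℝ → ℝ) : Prop :=
  (r < ⌈r⌉₊ → ∀ x : ℝ, 0 ≤ x → IntegrableOn (fun y => f y * (y - x) ^ (⌈r⌉₊ - r - 1)) (Ioi x)) ∧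
  ContDiffOn ℝ ⌈r⌉₊ (negFracIntegral (⌈r⌉₊ - r) f) (Ici 0)

end

/-! Everything rests on a contour formula. Put `c = b ^ (-α) * t`. Fourier inversion writes `P(x,t)`
as `π⁻¹` times the imaginary part of the integral of `exp (c z ^ α - x z)` along the positive
imaginary axis. By Cauchy's theorem (`rayIntegral_eq_of_decay`) the ray may be turned to any angle
`θ` with `π / (2 α) < θ < π / 2`. There `Re z > 0` and `Re z ^ α < 0`: the second inequality gives
absolute convergence for every real `x`, the first gives convergence of fractional integrals over
`(x, ∞)`.

On such a ray `-d/dx` inserts `z`, the negative fractional integral of order `s` inserts `z ^ (-s)`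
by Fubini and the Gamma integral (`integral_rayIntegral_mul_rpow`), and `d/dc` inserts `z ^ α`. So
the negative derivative of order `r` inserts `z ^ r` (`hasContNegRLDeriv_of_eqOn`), and the equation
compares two insertions of `z ^ α`. For order `α - 1` at `x = 0` the integrand `z ^ (α - 1) * exp (c
z ^ α)` is an exact derivative, with the real integral `-1 / (c α)`; its imaginary part vanishes,
which is the boundary condition (`sectorIntegral_sub_one_zero`).

The link with `h` is the duality of the indices `α` and `γ = 1 / α` (`stableDensity_duality`). For
`x > 0` the ray may be turned down to `φ = π γ / 2`, where `z ^ α` is purely imaginary; an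
integration by parts and the substitution `v = r ^ α` then produce the Fourier integral of `g_γ`.
This gives `h = α P` on `[0, ∞)`.

On the probabilistic side, monotone paths reduce `E_t < x` to `D(s) > t` for some `s` just below
`x`, and self-similarity of `D` gives the law of `E_t` with density `h`
(`IsStableSubordinator.hasLaw_hittingTime`). As `h` has total mass one, `P` has mass `1 / α` on the
positive half-line for every `t`, so both sides of the mass balance are zero. -/

/-- The integrand of `∫ z ^ β * exp (c z ^ α - x z) dz` along the ray of argument `θ`, in the polar
coordinate `r`. -/
noncomputable def ray (α β c x θ r : ℝ) : ℂ :=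
  ((r ^ β : ℝ) : ℂ) * Complex.exp (Complex.I * ((β + 1) * θ : ℝ)
    + c * (r ^ α : ℝ) * Complex.exp (Complex.I * (α * θ : ℝ))
    - x * r * Complex.exp (Complex.I * θ))

/-- The integral of `z ^ β * exp (c z ^ α - x z)` along the ray of argument `θ`. -/
noncomputable def rayIntegral (α β c x θ : ℝ) : ℂ := ∫ r in Ioi (0 : ℝ), ray α β c x θ r

theorem exp_I_mul_re (θ : ℝ) : (Complex.exp (Complex.I * θ)).re = Real.cos θ := by
  rw [mul_comm, Complex.exp_ofReal_mul_I_re]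

theorem norm_exp_I_mul (θ : ℝ) : ‖Complex.exp (Complex.I * θ)‖ = 1 := by
  rw [mul_comm, Complex.norm_exp_ofReal_mul_I]

/-! ### Integrals along rays -/

theorem norm_ray {r : ℝ} (α β c x θ : ℝ) (hr : 0 < r) :
    ‖ray α β c x θ r‖ =
      r ^ β * Real.exp (c * r ^ α * Real.cos (α * θ) - x * r * Real.cos θ) := by
  rw [ray, norm_mul, Complex.norm_real, Real.norm_of_nonneg (by positivity), Complex.norm_exp]
  congr 2
  simp only [Complex.sub_re, Complex.add_re, ← Complex.ofReal_mul, Complex.re_ofReal_mul,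
    exp_I_mul_re]
  simp

theorem measurable_ray (α β c x θ : ℝ) : Measurable (ray α β c x θ) := by
  unfold ray
  fun_prop

theorem continuous_ray_angle (α β c x r : ℝ) : Continuous fun θ => ray α β c x θ r := by
  unfold ray
  fun_prop

theorem hasDerivAt_ray_angle (α β c x θ r : ℝ) :
    HasDerivAt (fun θ => ray α β c x θ r)
      (Complex.I * (ray α β c x θ r * ((β + 1 : ℝ)
        + c * (α : ℝ) * (r ^ α : ℝ) * Complex.exp (Complex.I * (α * θ : ℝ))
        - x * r * Complex.exp (Complex.I * θ)))) θ := by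
  unfold ray
  have h : ∀ k : ℝ, HasDerivAt (fun θ : ℝ => Complex.I * ((k * θ : ℝ) : ℂ)) (Complex.I * k) θ := by
    intro k
    have := ((hasDerivAt_id θ).const_mul k).ofReal_comp.const_mul Complex.I
    simpa using this
  have h1 := (h 1).cexp
  simp only [one_mul, Complex.ofReal_one, mul_one] at h1
  have := (((h (β + 1)).add ((h α).cexp.const_mul (c * (r ^ α : ℝ) : ℂ))).sub
    (h1.const_mul (x * r : ℂ))).cexp.const_mul ((r ^ β : ℝ) : ℂ)
  convert! this using 1
  simp only [Pi.add_apply, Pi.sub_apply]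
  push_cast
  ring

/-- Cauchy-Riemann in polar coordinates: `r * ray` is `z` times the complex integrand, and
`Complex.I` times its radial derivative is the angular derivative of `ray`. The derivative of the
ray integral in the angle is therefore a boundary term. -/
theorem hasDerivAt_ray_radius {r : ℝ} (α β c x θ : ℝ) (hr : 0 < r) :
    HasDerivAt (fun r : ℝ => (r : ℂ) * ray α β c x θ r)
      (ray α β c x θ r * ((β + 1 : ℝ)
        + c * (α : ℝ) * (r ^ α : ℝ) * Complex.exp (Complex.I * (α * θ : ℝ))
        - x * r * Complex.exp (Complex.I * θ))) r := by
  unfold ray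
  have h : ∀ k : ℝ, HasDerivAt (fun r : ℝ => ((r ^ k : ℝ) : ℂ)) ((k * r ^ (k - 1) : ℝ) : ℂ) r :=
    fun k => (Real.hasDerivAt_rpow_const (Or.inl hr.ne')).ofReal_comp
  have h1 : HasDerivAt (fun r : ℝ => (r : ℂ)) 1 r := (hasDerivAt_id r).ofReal_comp
  have h2 := h1.mul ((h β).mul ((((hasDerivAt_const r (Complex.I * ((β + 1) * θ : ℝ))).add
    (((h α).const_mul (c : ℂ)).mul_const (Complex.exp (Complex.I * (α * θ : ℝ))))).sub
    ((h1.const_mul (x : ℂ)).mul_const (Complex.exp (Complex.I * θ)))).cexp))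
  convert! h2 using 1
  simp only [Pi.add_apply, Pi.sub_apply, Pi.mul_apply]
  have e : ∀ k : ℝ, (r ^ (k - 1) : ℝ) = r ^ k / r := fun k => Real.rpow_sub_one hr.ne' k
  have hr' : (r : ℂ) ≠ 0 := by exact_mod_cast hr.ne'
  rw [e, e]
  push_cast
  field_simp
  ring

theorem integrableOn_rpow_mul_exp {β k : ℝ} (hβ : -1 < β) (hk : 0 < k) (M : ℝ) :
    IntegrableOn (fun r : ℝ => r ^ β * Real.exp (M - k * r)) (Ioi 0) := by
  have := (integrableOn_rpow_mul_exp_neg_mul_rpow hβ one_pos hk).const_mul (Real.exp M)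
  refine this.congr (ae_of_all _ fun r => ?_)
  simp only [Real.rpow_one, Real.exp_sub, neg_mul, Real.exp_neg]
  ring

theorem integrableOn_ray {α β c x θ k M : ℝ} (hβ : -1 < β) (hk : 0 < k)
    (h : ∀ r : ℝ, 0 < r → c * r ^ α * Real.cos (α * θ) - x * r * Real.cos θ ≤ M - k * r) :
    IntegrableOn (ray α β c x θ) (Ioi 0) := by
  refine (integrableOn_rpow_mul_exp hβ hk M).mono' (measurable_ray ..).aestronglyMeasurable ?_
  filter_upwards [ae_restrict_mem measurableSet_Ioi] with r (hr : 0 < r)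
  rw [norm_ray _ _ _ _ _ hr]
  exact mul_le_mul_of_nonneg_left (Real.exp_le_exp.2 (h r hr)) (by positivity)

theorem norm_ray_deriv_le {α β c x θ k M r : ℝ} (hα : 0 ≤ α) (hβ : -1 < β) (hr : 0 < r)
    (h : c * r ^ α * Real.cos (α * θ) - x * r * Real.cos θ ≤ M - k * r) :
    ‖ray α β c x θ r * ((β + 1 : ℝ)
        + c * (α : ℝ) * (r ^ α : ℝ) * Complex.exp (Complex.I * (α * θ : ℝ))
        - x * r * Complex.exp (Complex.I * θ))‖ ≤
      (β + 1) * (r ^ β * Real.exp (M - k * r)) + |c| * α * (r ^ (β + α) * Real.exp (M - k * r))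
        + |x| * (r ^ (β + 1) * Real.exp (M - k * r)) := by
  have h1 : ‖ray α β c x θ r‖ ≤ r ^ β * Real.exp (M - k * r) := by
    rw [norm_ray _ _ _ _ _ hr]
    gcongr
  have h2 : ‖((β + 1 : ℝ) + c * (α : ℝ) * (r ^ α : ℝ) * Complex.exp (Complex.I * (α * θ : ℝ))
        - x * r * Complex.exp (Complex.I * θ) : ℂ)‖ ≤ (β + 1) + |c| * α * r ^ α + |x| * r := by
    refine (norm_sub_le _ _).trans (add_le_add ((norm_add_le _ _).trans (add_le_add ?_ ?_)) ?_)
    · rw [Complex.norm_real, Real.norm_of_nonneg (by linarith)]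
    · rw [norm_mul, norm_exp_I_mul, norm_mul, norm_mul, Complex.norm_real, Complex.norm_real,
        Complex.norm_real, Real.norm_eq_abs, Real.norm_of_nonneg hα,
        Real.norm_of_nonneg (by positivity), mul_one]
    · rw [norm_mul, norm_exp_I_mul, norm_mul, Complex.norm_real, Complex.norm_real,
        Real.norm_eq_abs, Real.norm_of_nonneg hr.le, mul_one]
  rw [norm_mul]
  refine (mul_le_mul h1 h2 (norm_nonneg _) (by positivity)).trans_eq ?_
  rw [Real.rpow_add hr, Real.rpow_add hr, Real.rpow_one]
  ring

/-- The integral of the angular derivative along a ray vanishes. -/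
theorem integral_ray_deriv_eq_zero {α β c x θ k M : ℝ} (hα : 0 < α) (hβ : -1 < β) (hk : 0 < k)
    (h : ∀ r : ℝ, 0 < r → c * r ^ α * Real.cos (α * θ) - x * r * Real.cos θ ≤ M - k * r) :
    IntegrableOn (fun r : ℝ => ray α β c x θ r * ((β + 1 : ℝ)
        + c * (α : ℝ) * (r ^ α : ℝ) * Complex.exp (Complex.I * (α * θ : ℝ))
        - x * r * Complex.exp (Complex.I * θ))) (Ioi 0) ∧
    ∫ r in Ioi (0 : ℝ), ray α β c x θ r * ((β + 1 : ℝ)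
        + c * (α : ℝ) * (r ^ α : ℝ) * Complex.exp (Complex.I * (α * θ : ℝ))
        - x * r * Complex.exp (Complex.I * θ)) = 0 := by
  have hint : IntegrableOn (fun r : ℝ => ray α β c x θ r * ((β + 1 : ℝ)
        + c * (α : ℝ) * (r ^ α : ℝ) * Complex.exp (Complex.I * (α * θ : ℝ))
        - x * r * Complex.exp (Complex.I * θ))) (Ioi 0) := by
    refine Integrable.mono' ((((integrableOn_rpow_mul_exp hβ hk M).const_mul (β + 1)).add
      ((integrableOn_rpow_mul_exp (β := β + α) (by linarith) hk M).const_mul (|c| * α))).add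
      ((integrableOn_rpow_mul_exp (β := β + 1) (by linarith) hk M).const_mul |x|)) ?_ ?_
    · have := measurable_ray α β c x θ
      exact Measurable.aestronglyMeasurable (by fun_prop)
    · filter_upwards [ae_restrict_mem measurableSet_Ioi] with r (hr : 0 < r)
      exact norm_ray_deriv_le hα.le hβ hr (h r hr)
  have hnorm : ∀ r : ℝ, 0 < r → ‖(r : ℂ) * ray α β c x θ r‖ ≤
      Real.exp M * (r ^ (β + 1) * Real.exp (-k * r)) := by
    intro r hr
    rw [norm_mul, Complex.norm_real, Real.norm_of_nonneg hr.le, norm_ray _ _ _ _ _ hr]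
    calc r * (r ^ β * Real.exp (c * r ^ α * Real.cos (α * θ) - x * r * Real.cos θ))
        ≤ r * (r ^ β * Real.exp (M - k * r)) := by
          exact mul_le_mul_of_nonneg_left (mul_le_mul_of_nonneg_left
            (Real.exp_le_exp.2 (h r hr)) (by positivity)) hr.le
      _ = _ := by
        rw [Real.rpow_add hr, Real.rpow_one, sub_eq_add_neg, Real.exp_add]
        ring_nf
  refine ⟨hint, ?_⟩
  have hlim : Tendsto (fun r : ℝ => Real.exp M * (r ^ (β + 1) * Real.exp (-k * r))) (𝓝[>] 0)
      (𝓝 0) := by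
    have : ContinuousAt (fun r : ℝ => Real.exp M * (r ^ (β + 1) * Real.exp (-k * r))) 0 := by
      have := Real.continuousAt_rpow_const 0 (β + 1) (Or.inr (by linarith))
      fun_prop
    have h0 := this.tendsto.mono_left (nhdsWithin_le_nhds (s := Ioi 0))
    simpa [Real.zero_rpow (by linarith : β + 1 ≠ 0)] using h0
  have := integral_Ioi_of_hasDerivAt_of_tendsto (a := 0) (m := 0)
    (f := fun r : ℝ => (r : ℂ) * ray α β c x θ r)
    ?_ (fun r hr => hasDerivAt_ray_radius α β c x θ hr) hint ?_
  · simpa using this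
  -- The factor `r` makes the value at the origin zero, and `β + 1 > 0` makes the right limit zero
  -- as well.
  · rw [← continuousWithinAt_Ioi_iff_Ici]
    simp only [ContinuousWithinAt, Complex.ofReal_zero, zero_mul]
    refine squeeze_zero_norm' ?_ hlim
    filter_upwards [self_mem_nhdsWithin] with r hr using hnorm r hr
  · have h0 := (tendsto_rpow_mul_exp_neg_mul_atTop_nhds_zero (β + 1) k hk).const_mul (Real.exp M)
    rw [mul_zero] at h0
    refine squeeze_zero_norm' ?_ h0
    filter_upwards [eventually_gt_atTop 0] with r hr using hnorm r hr

/-- Rotation of the ray of integration, by Cauchy's theorem. -/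
theorem rayIntegral_eq_of_decay {α β c x θ₁ θ₂ k M : ℝ} (hα : 0 < α) (hβ : -1 < β) (hk : 0 < k)
    (hθ : θ₁ ≤ θ₂) (h : ∀ θ ∈ Icc θ₁ θ₂, ∀ r : ℝ, 0 < r →
      c * r ^ α * Real.cos (α * θ) - x * r * Real.cos θ ≤ M - k * r) :
    rayIntegral α β c x θ₁ = rayIntegral α β c x θ₂ := by
  have hcont : ContinuousOn (rayIntegral α β c x) (Icc θ₁ θ₂) := by
    refine continuousOn_of_dominated (fun θ _ => (measurable_ray ..).aestronglyMeasurable) ?_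
      (integrableOn_rpow_mul_exp hβ hk M)
      (ae_of_all _ fun r => (continuous_ray_angle α β c x r).continuousOn)
    intro θ hθ
    filter_upwards [ae_restrict_mem measurableSet_Ioi] with r (hr : 0 < r)
    rw [norm_ray _ _ _ _ _ hr]
    exact mul_le_mul_of_nonneg_left (Real.exp_le_exp.2 (h θ hθ r hr)) (by positivity)
  have hderiv : ∀ θ ∈ Ioo θ₁ θ₂, HasDerivAt (rayIntegral α β c x) 0 θ := by
    intro θ hθ
    have hmem : Ioo θ₁ θ₂ ∈ 𝓝 θ := Ioo_mem_nhds hθ.1 hθ.2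
    obtain ⟨hint, hzero⟩ := integral_ray_deriv_eq_zero hα hβ hk (h θ (Ioo_subset_Icc_self hθ))
    have := (hasDerivAt_integral_of_dominated_loc_of_deriv_le (μ := volume.restrict (Ioi 0))
      (F := ray α β c x) (bound := fun r => (β + 1) * (r ^ β * Real.exp (M - k * r))
        + |c| * α * (r ^ (β + α) * Real.exp (M - k * r))
        + |x| * (r ^ (β + 1) * Real.exp (M - k * r))) hmem
      (Eventually.of_forall fun θ => (measurable_ray α β c x θ).aestronglyMeasurable)
      (integrableOn_ray hβ hk (h θ (Ioo_subset_Icc_self hθ)))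
      (hint.const_mul Complex.I).aestronglyMeasurable ?_ ?_
      (ae_of_all _ fun r θ _ => hasDerivAt_ray_angle α β c x θ r)).2
    · rwa [integral_const_mul, hzero, mul_zero] at this
    · filter_upwards [ae_restrict_mem measurableSet_Ioi] with r hr φ hφ
      rw [norm_mul, Complex.norm_I, one_mul]
      exact norm_ray_deriv_le hα.le hβ hr (h φ (Ioo_subset_Icc_self hφ) r hr)
    · exact (((integrableOn_rpow_mul_exp hβ hk M).const_mul (β + 1)).add
        ((integrableOn_rpow_mul_exp (β := β + α) (by linarith) hk M).const_mul (|c| * α))).add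
        ((integrableOn_rpow_mul_exp (β := β + 1) (by linarith) hk M).const_mul |x|)
  refine (constant_of_has_deriv_right_zero (f := rayIntegral α β c x) hcont ?_ θ₂
    (right_mem_Icc.2 hθ)).symm
  intro θ hθ'
  rcases hθ'.1.eq_or_lt with rfl | hlt
  -- Differentiation under the integral works only at interior angles; at the left end the right
  -- derivative is the limit of the interior derivatives.
  · have hs : Ioo θ₁ θ₂ ∈ 𝓝[>] θ₁ := Ioo_mem_nhdsGT hθ'.2
    refine hasDerivWithinAt_Ici_of_tendsto_deriv (s := Ioo θ₁ θ₂)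
      (fun θ hθ => (hderiv θ hθ).differentiableAt.differentiableWithinAt)
      ((hcont θ₁ (left_mem_Icc.2 hθ)).mono Ioo_subset_Icc_self) hs ?_
    refine tendsto_const_nhds.congr' ?_
    filter_upwards [hs] with θ hθ using (hderiv θ hθ).deriv.symm
  · exact (hderiv θ ⟨hlt, hθ'.2⟩).hasDerivWithinAt

/-! ### Ray integrals as functions of the position and the scale -/

theorem exists_neg_mul_rpow_add_mul_le {α k : ℝ} (hα : 1 < α) (hk : 0 < k) (X : ℝ) :
    ∃ M : ℝ, ∀ r : ℝ, 0 < r → -k * r ^ α + X * r ≤ M - r := by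
  -- For `r ≥ R` one has `k * r ^ (α - 1) ≥ |X| + 1`, so the power absorbs the linear terms; for `r
  -- ≤ R` the constant does.
  set R := ((|X| + 1) / k) ^ (1 / (α - 1)) with hR
  have hR0 : 0 ≤ R := by positivity
  refine ⟨(|X| + 1) * R, fun r hr => ?_⟩
  have hX : X ≤ |X| := le_abs_self X
  rcases le_total r R with h | h
  · have h1 : 0 ≤ k * r ^ α := by positivity
    have h2 : (X + 1) * r ≤ (|X| + 1) * R := by
      calc (X + 1) * r ≤ (|X| + 1) * r := by gcongr
        _ ≤ _ := by gcongr
    linarith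
  · have h1 : (|X| + 1) / k ≤ r ^ (α - 1) := by
      calc (|X| + 1) / k = R ^ (α - 1) := by
            rw [hR, ← Real.rpow_mul (by positivity), one_div, inv_mul_cancel₀ (by linarith),
              Real.rpow_one]
        _ ≤ _ := Real.rpow_le_rpow hR0 h (by linarith)
    rw [div_le_iff₀ hk] at h1
    have h2 : r ^ α = r ^ (α - 1) * r := by
      rw [← Real.rpow_add_one hr.ne', sub_add_cancel]
    have h3 : (X + 1) * r ≤ (r ^ (α - 1) * k) * r := by
      gcongr
      linarith
    have h4 : 0 ≤ (|X| + 1) * R := by positivity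
    rw [h2]
    linarith

/-- The power with `α > 1` beats the linear term. Uniformity in `c ≥ c₀` and `|x| ≤ X` makes one
exponential serve as dominating function for differentiation in the position and in the scale. -/
theorem exists_ray_exponent_le {α c₀ θ : ℝ} (hα : 1 < α) (hc₀ : 0 < c₀)
    (hθ : Real.cos (α * θ) < 0) (X : ℝ) :
    ∃ M : ℝ, ∀ c x r : ℝ, c₀ ≤ c → |x| ≤ X → 0 < r →
      c * r ^ α * Real.cos (α * θ) - x * r * Real.cos θ ≤ M - 1 * r := by
  obtain ⟨M, hM⟩ := exists_neg_mul_rpow_add_mul_le hα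
    (mul_pos hc₀ (neg_pos.2 hθ)) X
  refine ⟨M, fun c x r hc hx hr => ?_⟩
  have h1 : c * r ^ α * Real.cos (α * θ) ≤ c₀ * r ^ α * Real.cos (α * θ) := by
    have := Real.rpow_nonneg hr.le α
    exact mul_le_mul_of_nonpos_right (by gcongr) hθ.le
  have h2 : -(x * r * Real.cos θ) ≤ X * r := by
    have : |x * Real.cos θ| ≤ X := by
      rw [abs_mul]
      calc |x| * |Real.cos θ| ≤ |x| * 1 := by gcongr; exact Real.abs_cos_le_one θ
        _ ≤ X := by simpa using hx
    have h3 := mul_le_mul_of_nonneg_right ((neg_le_abs _).trans this) hr.le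
    linarith
  have := hM r hr
  linarith

theorem integrableOn_ray_of_cos_neg {α β c θ : ℝ} (hα : 1 < α) (hβ : -1 < β) (hc : 0 < c)
    (hθ : Real.cos (α * θ) < 0) (x : ℝ) : IntegrableOn (ray α β c x θ) (Ioi 0) := by
  obtain ⟨M, hM⟩ := exists_ray_exponent_le hα hc hθ |x|
  exact integrableOn_ray hβ one_pos fun r hr => hM c x r le_rfl le_rfl hr

theorem hasDerivAt_ray_pos {r : ℝ} (α β c x θ : ℝ) (hr : 0 < r) :
    HasDerivAt (fun x => ray α β c x θ r) (-ray α (β + 1) c x θ r) x := by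
  unfold ray
  have h1 : HasDerivAt (fun x : ℝ => (x : ℂ)) 1 x := (hasDerivAt_id x).ofReal_comp
  have := (((h1.mul_const (r : ℂ)).mul_const (Complex.exp (Complex.I * θ))).const_sub
    (Complex.I * ((β + 1) * θ : ℝ)
      + c * (r ^ α : ℝ) * Complex.exp (Complex.I * (α * θ : ℝ)))).cexp.const_mul ((r ^ β : ℝ) : ℂ)
  convert! this using 1
  rw [Real.rpow_add_one hr.ne', show Complex.I * ((β + 1 + 1) * θ : ℝ)
    = Complex.I * ((β + 1) * θ : ℝ) + Complex.I * θ by push_cast; ring]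
  simp only [Complex.exp_add, Complex.exp_sub]
  push_cast
  ring

theorem hasDerivAt_ray_scale {r : ℝ} (α β c x θ : ℝ) (hr : 0 < r) :
    HasDerivAt (fun c => ray α β c x θ r) (ray α (β + α) c x θ r) c := by
  unfold ray
  have h1 : HasDerivAt (fun c : ℝ => (c : ℂ)) 1 c := (hasDerivAt_id c).ofReal_comp
  have := ((((h1.mul_const ((r ^ α : ℝ) : ℂ)).mul_const
    (Complex.exp (Complex.I * (α * θ : ℝ)))).const_add
    (Complex.I * ((β + 1) * θ : ℝ))).sub_const (x * r * Complex.exp (Complex.I * θ))).cexp.const_mul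
      ((r ^ β : ℝ) : ℂ)
  convert! this using 1
  rw [Real.rpow_add hr, show Complex.I * ((β + α + 1) * θ : ℝ)
    = Complex.I * ((β + 1) * θ : ℝ) + Complex.I * (α * θ : ℝ) by push_cast; ring]
  simp only [Complex.exp_add, Complex.exp_sub]
  push_cast
  ring

theorem norm_ray_le {α β c x θ M r : ℝ} (hr : 0 < r)
    (h : c * r ^ α * Real.cos (α * θ) - x * r * Real.cos θ ≤ M - 1 * r) :
    ‖ray α β c x θ r‖ ≤ r ^ β * Real.exp (M - 1 * r) := by
  rw [norm_ray _ _ _ _ _ hr]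
  exact mul_le_mul_of_nonneg_left (Real.exp_le_exp.2 h) (by positivity)

theorem hasDerivAt_rayIntegral_pos {α β c θ : ℝ} (hα : 1 < α) (hβ : -1 < β) (hc : 0 < c)
    (hθ : Real.cos (α * θ) < 0) (x : ℝ) :
    HasDerivAt (fun x => rayIntegral α β c x θ) (-rayIntegral α (β + 1) c x θ) x := by
  obtain ⟨M, hM⟩ := exists_ray_exponent_le hα hc hθ (|x| + 1)
  have := (hasDerivAt_integral_of_dominated_loc_of_deriv_le (μ := volume.restrict (Ioi 0))
    (F := fun x => ray α β c x θ) (F' := fun x r => -ray α (β + 1) c x θ r)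
    (bound := fun r => r ^ (β + 1) * Real.exp (M - 1 * r)) (Metric.ball_mem_nhds x one_pos)
    (Eventually.of_forall fun x => (measurable_ray ..).aestronglyMeasurable)
    (integrableOn_ray_of_cos_neg hα hβ hc hθ x)
    (measurable_ray ..).neg.aestronglyMeasurable ?_
    (integrableOn_rpow_mul_exp (by linarith) one_pos M) ?_).2
  · rwa [integral_neg] at this
  · filter_upwards [ae_restrict_mem measurableSet_Ioi] with r hr y hy
    rw [norm_neg]
    refine norm_ray_le hr (hM c y r le_rfl ?_ hr)
    rw [Metric.mem_ball, Real.dist_eq] at hy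
    have := abs_sub_abs_le_abs_sub y x
    linarith
  · filter_upwards [ae_restrict_mem measurableSet_Ioi] with r hr y _
    exact hasDerivAt_ray_pos α β c y θ hr

theorem hasDerivAt_rayIntegral_scale {α β c θ : ℝ} (hα : 1 < α) (hβ : -1 < β) (hc : 0 < c)
    (hθ : Real.cos (α * θ) < 0) (x : ℝ) :
    HasDerivAt (fun c => rayIntegral α β c x θ) (rayIntegral α (β + α) c x θ) c := by
  -- The lower bound `c / 2` leaves a neighbourhood of scales around `c`.
  obtain ⟨M, hM⟩ := exists_ray_exponent_le hα (half_pos hc) hθ |x|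
  refine (hasDerivAt_integral_of_dominated_loc_of_deriv_le (μ := volume.restrict (Ioi 0))
    (F := fun c => ray α β c x θ) (F' := fun c r => ray α (β + α) c x θ r)
    (bound := fun r => r ^ (β + α) * Real.exp (M - 1 * r)) (Ioi_mem_nhds (half_lt_self hc))
    (Eventually.of_forall fun x => (measurable_ray ..).aestronglyMeasurable)
    (integrableOn_ray_of_cos_neg hα hβ hc hθ x)
    (measurable_ray ..).aestronglyMeasurable ?_
    (integrableOn_rpow_mul_exp (by linarith) one_pos M) ?_).2
  · filter_upwards [ae_restrict_mem measurableSet_Ioi] with r hr d (hd : c / 2 < d)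
    exact norm_ray_le hr (hM d x r hd.le le_rfl hr)
  · filter_upwards [ae_restrict_mem measurableSet_Ioi] with r hr y _
    exact hasDerivAt_ray_scale α β y x θ hr

/-- The factor `exp (c z ^ α)` has modulus at most one, and what remains is a Gamma integral. The
resulting power of `x` gives decay and integrability at infinity. -/
theorem norm_rayIntegral_le {α β c x θ : ℝ} (hβ : -1 < β) (hc : 0 ≤ c) (hx : 0 < x)
    (hαθ : Real.cos (α * θ) ≤ 0) (hθ : 0 < Real.cos θ) :
    ‖rayIntegral α β c x θ‖ ≤
      Real.Gamma (β + 1) * (Real.cos θ)⁻¹ ^ (β + 1) * x ^ (-(β + 1)) := by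
  have hint : IntegrableOn (fun r : ℝ => r ^ β * Real.exp (-(x * Real.cos θ * r))) (Ioi 0) := by
    simpa using integrableOn_rpow_mul_exp hβ (mul_pos hx hθ) 0
  have h1 : ‖rayIntegral α β c x θ‖ ≤
      ∫ r in Ioi (0 : ℝ), r ^ β * Real.exp (-(x * Real.cos θ * r)) := by
    refine norm_integral_le_of_norm_le hint ?_
    filter_upwards [ae_restrict_mem measurableSet_Ioi] with r (hr : 0 < r)
    rw [norm_ray _ _ _ _ _ hr]
    refine mul_le_mul_of_nonneg_left (Real.exp_le_exp.2 ?_) (by positivity)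
    have : c * r ^ α * Real.cos (α * θ) ≤ 0 := mul_nonpos_of_nonneg_of_nonpos (by positivity) hαθ
    linarith
  refine h1.trans_eq ?_
  have := Real.integral_rpow_mul_exp_neg_mul_Ioi (a := β + 1) (by linarith) (mul_pos hx hθ)
  rw [add_sub_cancel_right] at this
  rw [this, one_div, mul_inv, Real.mul_rpow (by positivity) (by positivity),
    Real.inv_rpow hx.le, ← Real.rpow_neg hx.le]
  ring

/-- The Laplace transform of a power at the point `x * exp (I * θ)` of the right half-plane. -/
theorem integral_rpow_mul_cexp_neg_mul {s x θ : ℝ} (hs : 0 < s) (hx : 0 < x) (hθ : 0 ≤ θ)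
    (hθ' : θ < Real.pi / 2) :
    ∫ u in Ioi (0 : ℝ), ((u ^ (s - 1) : ℝ) : ℂ) *
        Complex.exp (-(x * u * Complex.exp (Complex.I * θ)))
      = Real.Gamma s * (x ^ (-s) : ℝ) * Complex.exp (-(Complex.I * (s * θ : ℝ))) := by
  have hcos : 0 < Real.cos θ := Real.cos_pos_of_mem_Ioo ⟨by linarith [Real.pi_pos], hθ'⟩
  -- Index `1` and scale `0` leave `z ^ (s - 1) * exp (-x z)`, which is rotated from the real axis,
  -- where it is the Gamma integral.
  have hrot := rayIntegral_eq_of_decay (α := 1) (β := s - 1) (c := 0) (x := x) (M := 0)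
    one_pos (by linarith) (mul_pos hx hcos) hθ (by
      intro φ hφ r hr
      have := Real.cos_le_cos_of_nonneg_of_le_pi hφ.1 (by linarith [Real.pi_pos]) hφ.2
      have h2 := mul_le_mul_of_nonneg_left this (mul_pos hx hr).le
      linarith)
  have h0 : rayIntegral 1 (s - 1) 0 x 0 = Real.Gamma s * (x ^ (-s) : ℝ) := by
    have := Real.integral_rpow_mul_exp_neg_mul_Ioi hs hx
    rw [one_div, Real.inv_rpow hx.le, ← Real.rpow_neg hx.le, mul_comm] at this
    rw [← Complex.ofReal_mul, ← this, ← integral_complex_ofReal, rayIntegral]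
    simp [ray]
  have h1 : rayIntegral 1 (s - 1) 0 x θ = Complex.exp (Complex.I * (s * θ : ℝ)) *
      ∫ u in Ioi (0 : ℝ), ((u ^ (s - 1) : ℝ) : ℂ) *
        Complex.exp (-(x * u * Complex.exp (Complex.I * θ))) := by
    rw [← integral_const_mul, rayIntegral]
    congr 1 with r
    simp only [ray, sub_add_cancel, Complex.ofReal_zero, zero_mul, add_zero, Complex.exp_sub,
      Complex.exp_neg]
    ring
  rw [← h0, hrot, h1, mul_comm (Complex.exp _), mul_assoc, ← Complex.exp_add]
  simp

theorem ray_add_pos (α β c x u θ r : ℝ) :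
    ray α β c (x + u) θ r =
      ray α β c x θ r * Complex.exp (-(r * u * Complex.exp (Complex.I * θ))) := by
  rw [ray, ray, mul_assoc _ (Complex.exp _) (Complex.exp _), ← Complex.exp_add]
  push_cast
  ring_nf

/-- Tonelli: the inner integral over `u` of the norm is a Gamma integral proportional to `r ^ (-s)`,
so the question reduces to the ray integrand with exponent `β - s`. -/
theorem integrable_ray_mul_rpow {α β c θ s x : ℝ} (hα : 1 < α) (hβ : -1 < β - s) (hc : 0 < c)
    (hαθ : Real.cos (α * θ) < 0) (hθ : 0 < Real.cos θ) (hs : 0 < s) :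
    Integrable (Function.uncurry fun u r : ℝ => ray α β c (x + u) θ r * ((u ^ (s - 1) : ℝ) : ℂ))
      ((volume.restrict (Ioi 0)).prod (volume.restrict (Ioi 0))) := by
  have hnorm : ∀ u r : ℝ, 0 < u → 0 < r →
      ‖ray α β c (x + u) θ r * ((u ^ (s - 1) : ℝ) : ℂ)‖ =
        ‖ray α β c x θ r‖ * (u ^ (s - 1) * Real.exp (-(r * Real.cos θ * u))) := by
    intro u r hu hr
    rw [ray_add_pos, norm_mul, norm_mul, Complex.norm_exp, Complex.norm_real,
      Real.norm_of_nonneg (by positivity), ← Complex.ofReal_mul, Complex.neg_re,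
      Complex.re_ofReal_mul, exp_I_mul_re, mul_right_comm r]
    ring
  have hmeas : Measurable (Function.uncurry fun u r : ℝ =>
      ray α β c (x + u) θ r * ((u ^ (s - 1) : ℝ) : ℂ)) := by
    unfold ray
    fun_prop
  rw [integrable_prod_iff' hmeas.aestronglyMeasurable]
  constructor
  · filter_upwards [ae_restrict_mem measurableSet_Ioi] with r (hr : 0 < r)
    have hint : IntegrableOn (fun u : ℝ => u ^ (s - 1) * Real.exp (-(r * Real.cos θ * u)))
        (Ioi 0) := by
      simpa using integrableOn_rpow_mul_exp (by linarith : -1 < s - 1) (mul_pos hr hθ) 0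
    refine (hint.const_mul ‖ray α β c x θ r‖).mono'
      (hmeas.comp (measurable_id.prodMk measurable_const)).aestronglyMeasurable ?_
    filter_upwards [ae_restrict_mem measurableSet_Ioi] with u hu
    exact (hnorm u r hu hr).le
  · refine ((integrableOn_ray_of_cos_neg hα hβ hc hαθ x).norm.const_mul
      (Real.Gamma s * (Real.cos θ) ^ (-s))).congr ?_
    filter_upwards [ae_restrict_mem measurableSet_Ioi] with r (hr : 0 < r)
    simp only [Function.uncurry_apply_pair]
    rw [setIntegral_congr_fun measurableSet_Ioi fun u hu => hnorm u r hu hr, integral_const_mul,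
      Real.integral_rpow_mul_exp_neg_mul_Ioi hs (mul_pos hr hθ), one_div,
      Real.inv_rpow (by positivity), ← Real.rpow_neg (by positivity),
      Real.mul_rpow hr.le hθ.le, norm_ray _ _ _ _ _ hr, norm_ray _ _ _ _ _ hr, sub_eq_add_neg β,
      Real.rpow_add hr]
    ring

/-- The right-sided fractional integral of a ray integral. -/
theorem integral_rayIntegral_mul_rpow {α β c θ s : ℝ} (x : ℝ) (hα : 1 < α) (hβ : -1 < β - s)
    (hc : 0 < c) (hαθ : Real.cos (α * θ) < 0) (hθ : 0 ≤ θ) (hθ' : θ < Real.pi / 2) (hs : 0 < s) :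
    IntegrableOn (fun y => rayIntegral α β c y θ * ((y - x) ^ (s - 1) : ℝ)) (Ioi x) ∧
    ∫ y in Ioi x, rayIntegral α β c y θ * ((y - x) ^ (s - 1) : ℝ) =
      Real.Gamma s * rayIntegral α (β - s) c x θ := by
  have hcos : 0 < Real.cos θ := Real.cos_pos_of_mem_Ioo ⟨by linarith [Real.pi_pos], hθ'⟩
  have hprod := integrable_ray_mul_rpow (x := x) hα hβ hc hαθ hcos hs
  have hmp := measurePreserving_add_left (volume : Measure ℝ) x
  have hemb := measurableEmbedding_addLeft x
  have hpre : (fun u => x + u) ⁻¹' Ioi x = Ioi 0 := by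
    ext u
    simp
  have hinner : ∀ u : ℝ, ∫ r in Ioi (0 : ℝ), ray α β c (x + u) θ r * ((u ^ (s - 1) : ℝ) : ℂ) =
      rayIntegral α β c (x + u) θ * ((x + u - x) ^ (s - 1) : ℝ) := by
    intro u
    rw [integral_mul_const, rayIntegral, add_sub_cancel_left]
  constructor
  · have := hprod.integral_prod_left
    simp only [Function.uncurry_apply_pair, hinner] at this
    rw [← hmp.integrableOn_comp_preimage hemb, hpre]
    exact this
  · rw [← hmp.setIntegral_preimage_emb hemb, hpre]
    simp only [← hinner]
    rw [integral_integral_swap hprod, rayIntegral, ← integral_const_mul]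
    refine setIntegral_congr_fun measurableSet_Ioi fun r (hr : 0 < r) => ?_
    have h1 : ∀ u : ℝ, ray α β c (x + u) θ r * ((u ^ (s - 1) : ℝ) : ℂ) = ray α β c x θ r *
        (((u ^ (s - 1) : ℝ) : ℂ) * Complex.exp (-(r * u * Complex.exp (Complex.I * θ)))) := by
      intro u
      rw [ray_add_pos]
      ring
    simp only [h1]
    rw [integral_const_mul, integral_rpow_mul_cexp_neg_mul hs hr hθ hθ', ray, ray,
      sub_eq_add_neg β, Real.rpow_add hr, show Complex.I * ((β + -s + 1) * θ : ℝ) =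
        Complex.I * ((β + 1) * θ : ℝ) + -(Complex.I * (s * θ : ℝ)) by push_cast; ring]
    simp only [Complex.exp_add, Complex.exp_sub]
    push_cast
    ring

/-- The combination is the integral of the derivative of `exp (c z ^ α - x z)` along the ray; this
function is `1` at the origin and `0` at infinity. -/
theorem rayIntegral_relation {α c x θ k M : ℝ} (hα : 0 < α) (hk : 0 < k)
    (h : ∀ r : ℝ, 0 < r → c * r ^ α * Real.cos (α * θ) - x * r * Real.cos θ ≤ M - k * r) :
    c * α * rayIntegral α (α - 1) c x θ - x * rayIntegral α 0 c x θ = -1 := by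
  set f : ℝ → ℂ := fun r => Complex.exp (c * (r ^ α : ℝ) * Complex.exp (Complex.I * (α * θ : ℝ))
    - x * r * Complex.exp (Complex.I * θ)) with hf
  have h1 := (integrableOn_ray (β := α - 1) (by linarith) hk h).const_mul (c * α : ℂ)
  have h2 := (integrableOn_ray (β := 0) (by norm_num) hk h).const_mul (x : ℂ)
  have hderiv : ∀ r ∈ Ioi (0 : ℝ), HasDerivAt f
      (c * α * ray α (α - 1) c x θ r - x * ray α 0 c x θ r) r := by
    intro r (hr : 0 < r)
    have h1 : HasDerivAt (fun r : ℝ => (r : ℂ)) 1 r := (hasDerivAt_id r).ofReal_comp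
    have h3 : HasDerivAt (fun r : ℝ => ((r ^ α : ℝ) : ℂ)) ((α * r ^ (α - 1) : ℝ) : ℂ) r :=
      (Real.hasDerivAt_rpow_const (Or.inl hr.ne')).ofReal_comp
    have := (((h3.const_mul (c : ℂ)).mul_const (Complex.exp (Complex.I * (α * θ : ℝ)))).sub
      ((h1.const_mul (x : ℂ)).mul_const (Complex.exp (Complex.I * θ)))).cexp
    convert! this using 1
    simp only [ray, Pi.sub_apply, Real.rpow_zero, sub_add_cancel, zero_add, one_mul,
      Complex.exp_add, Complex.exp_sub]
    push_cast
    ring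
  have hlim : Tendsto f atTop (𝓝 0) := by
    have h0 := (tendsto_rpow_mul_exp_neg_mul_atTop_nhds_zero 0 k hk).const_mul (Real.exp M)
    rw [mul_zero] at h0
    refine squeeze_zero_norm' ?_ h0
    filter_upwards [eventually_gt_atTop 0] with r hr
    rw [hf, Real.rpow_zero, one_mul, ← Real.exp_add, Complex.norm_exp, Real.exp_le_exp]
    refine le_trans (le_of_eq ?_) ((h r hr).trans_eq (by ring))
    simp only [Complex.sub_re, ← Complex.ofReal_mul, Complex.re_ofReal_mul, exp_I_mul_re]
  have hcont : Continuous f := by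
    have : Continuous fun r : ℝ => r ^ α := Real.continuous_rpow_const hα.le
    fun_prop
  have := integral_Ioi_of_hasDerivAt_of_tendsto hcont.continuousWithinAt hderiv (h1.sub h2) hlim
  rw [integral_sub h1 h2, integral_const_mul, integral_const_mul] at this
  simpa [hf, Real.zero_rpow hα.ne', rayIntegral] using this

/-! ### Stable densities as ray integrals, and duality -/

theorem stableCharFun_of_pos {r : ℝ} (a η c : ℝ) (hr : 0 < r) :
    stableCharFun a η c r =
      Complex.exp (-(c * (r ^ a : ℝ) * Complex.exp (-(Complex.I * (Real.pi * η / 2 : ℝ))))) := by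
  rw [stableCharFun, abs_of_pos hr, div_self hr.ne', mul_one, Complex.ofReal_mul c]

theorem stableCharFun_neg (a η c l : ℝ) :
    stableCharFun a η c (-l) = (starRingEnd ℂ) (stableCharFun a η c l) := by
  simp only [stableCharFun, ← Complex.exp_conj, map_neg, map_mul, Complex.conj_ofReal,
    Complex.conj_I, abs_neg]
  congr 5
  push_cast
  ring

theorem measurable_stableCharFun (a η c : ℝ) : Measurable (stableCharFun a η c) := by
  unfold stableCharFun
  fun_prop

theorem norm_stableCharFun_of_pos {r : ℝ} (a η c : ℝ) (hr : 0 < r) :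
    ‖stableCharFun a η c r‖ = Real.exp (-(c * Real.cos (Real.pi * η / 2)) * r ^ a) := by
  rw [stableCharFun_of_pos _ _ _ hr, Complex.norm_exp, Complex.neg_re, ← Complex.ofReal_mul,
    Complex.re_ofReal_mul, ← mul_neg Complex.I, ← Complex.ofReal_neg, exp_I_mul_re, Real.cos_neg]
  ring_nf

theorem integrable_stableCharFun {a η c : ℝ} (ha : 0 < a) (hc : 0 < c)
    (hη : 0 < Real.cos (Real.pi * η / 2)) : Integrable (stableCharFun a η c) := by
  have hpos : IntegrableOn (stableCharFun a η c) (Ioi 0) := by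
    refine (integrableOn_rpow_mul_exp_neg_mul_rpow (s := 0) (by norm_num) ha
      (mul_pos hc hη)).mono' (measurable_stableCharFun ..).aestronglyMeasurable ?_
    filter_upwards [ae_restrict_mem measurableSet_Ioi] with r hr
    rw [norm_stableCharFun_of_pos _ _ _ hr, Real.rpow_zero, one_mul]
  have hneg : IntegrableOn (stableCharFun a η c) (Iic 0) := by
    rw [integrableOn_Iic_iff_integrableOn_Iio]
    have h1 : IntegrableOn (fun l => stableCharFun a η c (-l)) (Ioi 0) := by
      simp only [stableCharFun_neg]
      exact (Complex.conjLIE.integrable_comp_iff (φ := stableCharFun a η c)).2 hpos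
    have := (Measure.measurePreserving_neg (volume : Measure ℝ)).integrableOn_comp_preimage
      (Homeomorph.neg ℝ).measurableEmbedding (f := stableCharFun a η c) (s := Iio 0)
    rw [← this]
    simpa [Function.comp_def] using h1
  rw [← integrableOn_univ, ← Iic_union_Ioi (a := (0 : ℝ))]
  exact hneg.union hpos

theorem stableDensity_eq_integral_Ioi {a η c : ℝ} (h : Integrable (stableCharFun a η c)) (x : ℝ) :
    stableDensity a η c x = Real.pi⁻¹ * (∫ r in Ioi (0 : ℝ),
      Complex.exp (-(Complex.I * r * x)) * stableCharFun a η c r).re := by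
  set F : ℝ → ℂ := fun l => Complex.exp (-(Complex.I * l * x)) * stableCharFun a η c l with hF
  have hFint : Integrable F := by
    refine h.bdd_mul (c := 1) (by fun_prop) (ae_of_all _ fun l => ?_)
    rw [Complex.norm_exp]
    simp
  have hneg : ∫ l in Iic (0 : ℝ), F l = (starRingEnd ℂ) (∫ l in Ioi (0 : ℝ), F l) := by
    rw [← neg_zero, ← integral_comp_neg_Ioi, ← integral_conj, neg_zero]
    refine integral_congr_ae (ae_of_all _ fun l => ?_)
    simp only [hF, stableCharFun_neg, map_mul, ← Complex.exp_conj, map_neg, Complex.conj_ofReal,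
      Complex.conj_I]
    push_cast
    ring_nf
  rw [stableDensity, ← Complex.ofReal_inv, Complex.re_ofReal_mul,
    ← intervalIntegral.integral_Iic_add_Ioi (b := 0) hFint.integrableOn hFint.integrableOn, hneg,
    Complex.add_re, Complex.conj_re]
  field_simp
  ring

theorem cos_pi_mul_two_sub_div_two_pos {α : ℝ} (hα : 1 < α) (hα2 : α ≤ 2) :
    0 < Real.cos (Real.pi * (2 - α) / 2) := by
  have := Real.pi_pos
  exact Real.cos_pos_of_mem_Ioo ⟨by nlinarith, by nlinarith⟩

/-- Substitute `z = I * l`. The asymmetry `2 - α` is the one for which the exponent becomes `c z ^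
α`, since `exp (-I π (2 - α) / 2) = -exp (I π α / 2)`. The factor `I` in `dz` turns the real part
into the imaginary part. -/
theorem stableDensity_eq_rayIntegral_pi_div_two {α c : ℝ} (hα : 1 < α) (hα2 : α ≤ 2) (hc : 0 < c)
    (x : ℝ) : stableDensity α (2 - α) c x =
      Real.pi⁻¹ * (rayIntegral α 0 c x (Real.pi / 2)).im := by
  have hI : Complex.exp (Complex.I * (Real.pi / 2 : ℝ)) = Complex.I := by
    rw [mul_comm]
    push_cast
    exact Complex.exp_pi_div_two_mul_I
  rw [stableDensity_eq_integral_Ioi (integrable_stableCharFun (by linarith) hc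
    (cos_pi_mul_two_sub_div_two_pos hα hα2))]
  congr 1
  have : rayIntegral α 0 c x (Real.pi / 2) = Complex.I * ∫ r in Ioi (0 : ℝ),
      Complex.exp (-(Complex.I * r * x)) * stableCharFun α (2 - α) c r := by
    rw [← integral_const_mul, rayIntegral]
    refine setIntegral_congr_fun measurableSet_Ioi fun r hr => ?_
    have hexp : Complex.exp (-(Complex.I * (Real.pi * (2 - α) / 2 : ℝ))) =
        -Complex.exp (Complex.I * (α * (Real.pi / 2) : ℝ)) := by
      rw [show -(Complex.I * ((Real.pi * (2 - α) / 2 : ℝ) : ℂ)) =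
        Complex.I * (α * (Real.pi / 2) : ℝ) - Real.pi * Complex.I by push_cast; ring,
        Complex.exp_sub_pi_mul_I]
    simp only [ray, stableCharFun_of_pos _ _ _ hr, hexp, zero_add, one_mul, Real.rpow_zero,
      Complex.exp_sub, Complex.exp_add, hI, Complex.exp_neg]
    rw [mul_neg, Complex.exp_neg, inv_inv]
    push_cast
    ring_nf
  rw [this, Complex.I_mul_im]

theorem cos_neg_of_pi_div_two_lt {α θ : ℝ} (hα : 1 < α) (hα2 : α ≤ 2)
    (hαθ : Real.pi / 2 < α * θ) (hθ : θ ≤ Real.pi / 2) : Real.cos (α * θ) < 0 := by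
  have := Real.pi_pos
  refine Real.cos_neg_of_pi_div_two_lt_of_lt hαθ ?_
  nlinarith

theorem stableDensity_eq_rayIntegral {α c θ : ℝ} (hα : 1 < α) (hα2 : α ≤ 2) (hc : 0 < c)
    (hαθ : Real.pi / 2 < α * θ) (hθ : θ ≤ Real.pi / 2) (x : ℝ) :
    stableDensity α (2 - α) c x = Real.pi⁻¹ * (rayIntegral α 0 c x θ).im := by
  rw [stableDensity_eq_rayIntegral_pi_div_two hα hα2 hc]
  have hcos := cos_neg_of_pi_div_two_lt hα hα2 hαθ hθ
  obtain ⟨M, hM⟩ := exists_neg_mul_rpow_add_mul_le hα (mul_pos hc (neg_pos.2 hcos)) |x|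
  congr 2
  refine (rayIntegral_eq_of_decay (M := M) (by linarith) (by norm_num) one_pos hθ ?_).symm
  intro φ hφ r hr
  have h1 : Real.cos (α * φ) ≤ Real.cos (α * θ) := by
    refine Real.cos_le_cos_of_nonneg_of_le_pi (by linarith [Real.pi_pos]) ?_ (by gcongr; exact hφ.1)
    have := hφ.2
    have := Real.pi_pos
    nlinarith
  have h2 : c * r ^ α * Real.cos (α * φ) ≤ c * r ^ α * Real.cos (α * θ) := by gcongr
  have h3 : -(x * r * Real.cos φ) ≤ |x| * r := by
    have : |x * Real.cos φ| ≤ |x| := by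
      rw [abs_mul]
      exact mul_le_of_le_one_right (abs_nonneg x) (Real.abs_cos_le_one φ)
    have := mul_le_mul_of_nonneg_right ((neg_le_abs _).trans this) hr.le
    linarith
  have := hM r hr
  linarith

/-- The duality between the stable laws of the indices `α` and `1 / α`. -/
theorem stableDensity_duality {γ α b t x : ℝ} (hγ : 1 / 2 ≤ γ) (hγ1 : γ < 1) (hα : α = 1 / γ)
    (hb : 0 < b) (ht : 0 < t) (hx : 0 < x) :
    stableDensity α (2 - α) (b ^ (-α) * t) x =
      t * x ^ (-1 - α) * stableDensity γ γ b (t * x ^ (-α)) := by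
  have hγ0 : 0 < γ := by linarith
  have hα1 : 1 < α := by rw [hα, lt_div_iff₀ hγ0]; linarith
  have hα2 : α ≤ 2 := by rw [hα, div_le_iff₀ hγ0]; linarith
  have hαγ : α * γ = 1 := by rw [hα]; field_simp
  have hpi := Real.pi_pos
  set c := b ^ (-α) * t with hc
  have hc0 : 0 < c := by positivity
  -- The midpoint between `φ` and `π / 2`.
  set θ := Real.pi * (γ + 1) / 4 with hθ
  set φ := Real.pi * γ / 2 with hφ
  have hφ' : α * φ = Real.pi / 2 := by
    rw [hφ, show α * (Real.pi * γ / 2) = α * γ * (Real.pi / 2) by ring, hαγ, one_mul]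
  have hφθ : φ < θ := by rw [hφ, hθ]; nlinarith
  have hφ0 : 0 < φ := by positivity
  have hθ2 : θ < Real.pi / 2 := by rw [hθ]; nlinarith
  have hαθ : Real.pi / 2 < α * θ := by
    rw [← hφ']
    gcongr
  have hcosθ : 0 < Real.cos θ := Real.cos_pos_of_mem_Ioo ⟨by linarith, hθ2⟩
  -- At `φ` the factor `exp (c z ^ α)` only oscillates, so the decay has to come from `exp (-x z)`;
  -- this needs `x > 0`.
  have hdecay : ∀ ψ ∈ Icc φ θ, ∀ r : ℝ, 0 < r →
      c * r ^ α * Real.cos (α * ψ) - x * r * Real.cos ψ ≤ 0 - x * Real.cos θ * r := by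
    intro ψ hψ r hr
    have h1 : Real.cos θ ≤ Real.cos ψ :=
      Real.cos_le_cos_of_nonneg_of_le_pi (hφ0.le.trans hψ.1) (by linarith) hψ.2
    have h2 : Real.cos (α * ψ) ≤ 0 := by
      refine Real.cos_nonpos_of_pi_div_two_le_of_le ?_ ?_
      · rw [← hφ']
        have := hψ.1
        gcongr
      · have := hψ.2
        nlinarith
    have h3 : c * r ^ α * Real.cos (α * ψ) ≤ 0 :=
      mul_nonpos_of_nonneg_of_nonpos (by positivity) h2
    have h4 := mul_le_mul_of_nonneg_left h1 (mul_pos hx hr).le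
    linarith
  have hrot := rayIntegral_eq_of_decay (β := 0) (by linarith) (by norm_num) (mul_pos hx hcosθ)
    hφθ.le hdecay
  have hrel := rayIntegral_relation (by linarith) (mul_pos hx hcosθ)
    (hdecay φ (left_mem_Icc.2 hφθ.le))
  have hI : Complex.exp (Complex.I * (Real.pi / 2 : ℝ)) = Complex.I := by
    rw [mul_comm]
    push_cast
    exact Complex.exp_pi_div_two_mul_I
  set y := t * x ^ (-α) with hy
  set κ := b ^ α * x ^ (-α) with hκ
  have hκ0 : 0 < κ := by positivity
  -- The dilation `v = κ * w` is chosen to turn `c * v` into `y * w` and `x * v ^ γ` into `b * w ^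
  -- γ`, the exponents of the Fourier integral of `g_γ` at `y`.
  have hcκ : c * κ = y := by
    rw [hc, hκ, hy, Real.rpow_neg hb.le]
    field_simp
  have hκγ : x * κ ^ γ = b := by
    rw [hκ, Real.mul_rpow (by positivity) (by positivity), ← Real.rpow_mul hb.le,
      ← Real.rpow_mul hx.le, hαγ, neg_mul, hαγ, Real.rpow_one, Real.rpow_neg_one]
    field_simp
  have hsub : α * rayIntegral α (α - 1) c x φ = Complex.I * (κ * (starRingEnd ℂ)
      (∫ r in Ioi (0 : ℝ), Complex.exp (-(Complex.I * r * y)) * stableCharFun γ γ b r)) := by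
    set g : ℝ → ℂ := fun v =>
      Complex.I * Complex.exp (c * v * Complex.I - x * (v ^ γ : ℝ) * Complex.exp (Complex.I * φ))
      with hg
    have h1 : α * rayIntegral α (α - 1) c x φ = ∫ v in Ioi (0 : ℝ), g v := by
      rw [← integral_comp_rpow_Ioi_of_pos (g := g) (by linarith : 0 < α), rayIntegral,
        ← integral_const_mul]
      refine setIntegral_congr_fun measurableSet_Ioi fun r (hr : 0 < r) => ?_
      simp only [hg, ray, sub_add_cancel, hφ', ← Real.rpow_mul hr.le, hαγ, Real.rpow_one, hI,
        Complex.exp_add, Complex.exp_sub, Complex.real_smul]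
      push_cast
      ring
    have h2 : ∫ v in Ioi (0 : ℝ), g v = κ * ∫ w in Ioi (0 : ℝ), g (κ * w) := by
      rw [integral_comp_mul_left_Ioi g 0 hκ0, mul_zero, Complex.real_smul, ← mul_assoc,
        ← Complex.ofReal_mul, mul_inv_cancel₀ hκ0.ne', Complex.ofReal_one, one_mul]
    rw [h1, h2, ← integral_conj, ← integral_const_mul, ← integral_const_mul, ← integral_const_mul]
    refine setIntegral_congr_fun measurableSet_Ioi fun w (hw : 0 < w) => ?_
    simp only [hg, stableCharFun_of_pos _ _ _ hw, map_mul, ← Complex.exp_conj, map_neg,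
      Complex.conj_ofReal, Complex.conj_I, neg_mul, neg_neg, ← hφ]
    rw [Real.mul_rpow hκ0.le hw.le, ← Complex.exp_add, ← hcκ, ← hκγ]
    push_cast
    ring_nf
  -- The real constant `-1` of the relation drops out of the imaginary part.
  have him : x * (rayIntegral α 0 c x φ).im = y * (∫ r in Ioi (0 : ℝ),
      Complex.exp (-(Complex.I * r * y)) * stableCharFun γ γ b r).re := by
    have := congrArg Complex.im hrel
    rw [mul_assoc, hsub, Complex.sub_im, Complex.im_ofReal_mul, Complex.im_ofReal_mul,
      Complex.I_mul_im, Complex.re_ofReal_mul, Complex.conj_re, ← mul_assoc, hcκ, Complex.neg_im,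
      Complex.one_im] at this
    linarith
  have hcosφ : 0 < Real.cos (Real.pi * γ / 2) :=
    Real.cos_pos_of_mem_Ioo ⟨by linarith, by linarith⟩
  rw [stableDensity_eq_rayIntegral hα1 hα2 hc0 hαθ hθ2.le, ← hrot,
    stableDensity_eq_integral_Ioi (integrable_stableCharFun hγ0 hb hcosφ),
    sub_eq_add_neg, Real.rpow_add hx, Real.rpow_neg_one]
  field_simp
  rw [mul_comm, him]

/-! ### Fourier inversion for finite measures -/

/-- The density at `x`, by Fourier inversion, of a law with integrable characteristic function. -/
noncomputable def inversionDensity (φ : ℝ → ℂ) (x : ℝ) : ℂ :=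
  ((2 * Real.pi : ℝ) : ℂ)⁻¹ * ∫ l : ℝ, Complex.exp (-(Complex.I * (l : ℂ) * (x : ℂ))) * φ l

/-- Fourier self-adjointness is used twice: for the inverse transform of `f` against `μ`, and for
`f` against the characteristic function. The dilation by `2 * Real.pi` reconciles the two Fourier
kernels. -/
theorem integral_schwartz_eq_integral_inversionDensity {μ : Measure ℝ} [IsFiniteMeasure μ]
    (h : Integrable (charFun μ)) (f : SchwartzMap ℝ ℂ) :
    ∫ x, f x ∂μ = ∫ x, f x * inversionDensity (charFun μ) x := by
  set g : SchwartzMap ℝ ℂ := FourierTransform.fourierInv f with hg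
  have hfg : ∀ x, f x =
      VectorFourier.fourierIntegral Real.fourierChar volume (innerₗ ℝ) (g : ℝ → ℂ) x := by
    intro x
    have : f = FourierTransform.fourier g := (FourierTransform.fourier_fourierInv_eq f).symm
    conv_lhs => rw [this, SchwartzMap.fourier_coe]
    rfl
  have hgf : ∀ x, g (-x) =
      VectorFourier.fourierIntegral Real.fourierChar volume (innerₗ ℝ) (f : ℝ → ℂ) x := by
    intro x
    rw [hg, SchwartzMap.fourierInv_coe, Real.fourierInv_eq_fourier_neg, neg_neg]
    rfl
  have hL : Continuous fun p : ℝ × ℝ => (innerₗ ℝ) p.1 p.2 := by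
    simp only [innerₗ_apply_apply]
    fun_prop
  have hpi := Real.pi_pos
  have hψ : Integrable fun v : ℝ => charFun μ (2 * Real.pi * v) := h.comp_mul_left' (by positivity)
  have h1 := VectorFourier.integral_fourierIntegral_smul_eq_flip (L := innerₗ ℝ) (μ := volume)
    (ν := μ) (f := (g : ℝ → ℂ)) (g := (1 : ℝ → ℂ)) Real.continuous_fourierChar hL g.integrable
    (integrable_const _)
  have h2 := VectorFourier.integral_fourierIntegral_smul_eq_flip (L := innerₗ ℝ) (μ := volume)
    (ν := volume) (f := (f : ℝ → ℂ)) Real.continuous_fourierChar hL f.integrable hψ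
  rw [flip_innerₗ] at h1 h2
  have h3 : ∀ x : ℝ, VectorFourier.fourierIntegral Real.fourierChar μ (innerₗ ℝ) (1 : ℝ → ℂ) x =
      charFun μ (-(2 * Real.pi * x)) := by
    intro x
    rw [charFun_eq_fourierIntegral']
    congr 1
    simp only [smul_eq_mul]
    field_simp
  have h4 : ∀ x : ℝ, VectorFourier.fourierIntegral Real.fourierChar volume (innerₗ ℝ)
      (fun v : ℝ => charFun μ (2 * Real.pi * v)) x = inversionDensity (charFun μ) x := by
    intro x
    have := Measure.integral_comp_mul_left
      (fun l : ℝ => Complex.exp (-(Complex.I * (l : ℂ) * (x : ℂ))) * charFun μ l) (2 * Real.pi)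
    rw [abs_of_pos (by positivity), Complex.real_smul, Complex.ofReal_inv] at this
    rw [inversionDensity, ← this, VectorFourier.fourierIntegral]
    refine integral_congr_ae (ae_of_all _ fun v => ?_)
    simp only [innerₗ_apply_apply, Circle.smul_def, Real.fourierChar_apply, smul_eq_mul,
      RCLike.inner_apply, conj_trivial]
    congr 2
    push_cast
    ring
  simp only [Pi.one_apply, smul_eq_mul, mul_one, h3, ← hfg] at h1
  simp only [smul_eq_mul, h4, ← hgf] at h2
  rw [h1, ← h2, ← integral_neg_eq_self]
  simp

theorem continuous_inversionDensity {φ : ℝ → ℂ} (h : Integrable φ) :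
    Continuous (inversionDensity φ) := by
  refine continuous_const.mul (continuous_of_dominated (bound := fun l => ‖φ l‖)
    (fun x => ?_) (fun x => ae_of_all _ fun l => ?_) h.norm (ae_of_all _ fun l => by fun_prop))
  · exact (Continuous.aestronglyMeasurable (by fun_prop)).mul h.aestronglyMeasurable
  · rw [norm_mul, Complex.norm_exp]
    simp

theorem measureReal_Ioo_eq_integral_inversionDensity {μ : Measure ℝ} [IsFiniteMeasure μ]
    (h : Integrable (charFun μ)) (a b : ℝ) :
    μ.real (Ioo a b) = ∫ x in Ioo a b, (inversionDensity (charFun μ) x).re := by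
  obtain ⟨f, hfsupp, hfsmooth, hfrange⟩ := (isOpen_Ioo (a := a) (b := b)).exists_contDiff_support_eq
    (n := ⊤)
  have hf0 : ∀ x, 0 ≤ f x := fun x => (hfrange (mem_range_self x)).1
  have hzero : ∀ x, x ∉ Ioo a b → f x = 0 := by
    intro x hx
    rwa [← hfsupp, Function.notMem_support] at hx
  -- Smooth functions supported in the interval which increase to its indicator: where `f x > 0`,
  -- the value is `1` as soon as `n * f x ≥ 1`.
  set F : ℕ → ℝ → ℝ := fun n x => Real.smoothTransition (n * f x) with hF
  have hFsmooth : ∀ n, ContDiff ℝ ((⊤ : ℕ∞) : WithTop ℕ∞) fun x => (F n x : ℂ) := fun n =>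
    Complex.ofRealCLM.contDiff.comp
      (Real.smoothTransition.contDiff.comp (contDiff_const.mul hfsmooth))
  have hFsupp : ∀ n x, x ∉ Ioo a b → F n x = 0 := by
    intro n x hx
    simp [hF, hzero x hx]
  have hFcompact : ∀ n, HasCompactSupport fun x => (F n x : ℂ) := fun n =>
    HasCompactSupport.intro isCompact_Icc fun x hx => by
      rw [hFsupp n x fun h => hx (Ioo_subset_Icc_self h), Complex.ofReal_zero]
  have hFle : ∀ n x, ‖F n x‖ ≤ (Ioo a b).indicator 1 x := by
    intro n x
    by_cases hx : x ∈ Ioo a b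
    · rw [indicator_of_mem hx, Pi.one_apply, Real.norm_of_nonneg (Real.smoothTransition.nonneg _)]
      exact Real.smoothTransition.le_one _
    · rw [hFsupp n x hx, indicator_of_notMem hx, norm_zero]
  have hFlim : ∀ x, Tendsto (fun n => F n x) atTop (𝓝 ((Ioo a b).indicator 1 x)) := by
    intro x
    by_cases hx : x ∈ Ioo a b
    · rw [indicator_of_mem hx, Pi.one_apply]
      have hfx : 0 < f x := (hf0 x).lt_of_ne' (by
        rwa [← hfsupp, Function.mem_support] at hx)
      refine tendsto_const_nhds.congr' ?_
      filter_upwards [(tendsto_natCast_atTop_atTop.atTop_mul_const hfx).eventually_ge_atTop 1]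
        with n hn
      exact (Real.smoothTransition.one_of_one_le hn).symm
    · simp only [hFsupp _ x hx, indicator_of_notMem hx, tendsto_const_nhds]
  set p : ℝ → ℝ := fun x => (inversionDensity (charFun μ) x).re with hp
  have hpcont : Continuous p := Complex.continuous_re.comp (continuous_inversionDensity h)
  have heq : ∀ n, ∫ x, F n x ∂μ = ∫ x, F n x * p x := by
    intro n
    have := integral_schwartz_eq_integral_inversionDensity h
      ((hFcompact n).toSchwartzMap (hFsmooth n))
    have hint : Integrable fun x => (F n x : ℂ) * inversionDensity (charFun μ) x :=
      (((hFsmooth n).continuous.mul (continuous_inversionDensity h)).integrable_of_hasCompactSupport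
        (hFcompact n).mul_right)
    have h2 := congrArg Complex.re this
    simp only [HasCompactSupport.toSchwartzMap_toFun] at h2
    rw [integral_complex_ofReal, Complex.ofReal_re, ← RCLike.re_eq_complex_re,
      ← integral_re hint] at h2
    rw [h2]
    simp [hp]
  have hFcont : ∀ n, Continuous (F n) := fun n =>
    Real.smoothTransition.continuous.comp (continuous_const.mul hfsmooth.continuous)
  have hlim1 : Tendsto (fun n => ∫ x, F n x ∂μ) atTop (𝓝 (μ.real (Ioo a b))) := by
    rw [← integral_indicator_one measurableSet_Ioo]
    exact tendsto_integral_of_dominated_convergence _ (fun n => (hFcont n).aestronglyMeasurable)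
      ((integrable_const 1).indicator measurableSet_Ioo)
      (fun n => ae_of_all _ (hFle n)) (ae_of_all _ hFlim)
  have hlim2 : Tendsto (fun n => ∫ x, F n x * p x) atTop (𝓝 (∫ x in Ioo a b, p x)) := by
    rw [← integral_indicator measurableSet_Ioo]
    refine tendsto_integral_of_dominated_convergence ((Ioo a b).indicator fun x => ‖p x‖)
      (fun n => ((hFcont n).mul hpcont).aestronglyMeasurable) ?_ (fun n => ae_of_all _ fun x => ?_)
      (ae_of_all _ fun x => ?_)
    · exact ((hpcont.norm.integrableOn_Icc (a := a) (b := b)).mono_set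
        Ioo_subset_Icc_self).integrable_indicator measurableSet_Ioo
    · rw [norm_mul]
      refine (mul_le_mul_of_nonneg_right (hFle n x) (norm_nonneg _)).trans_eq ?_
      by_cases hx : x ∈ Ioo a b <;> simp [hx]
    · convert (hFlim x).mul_const (p x) using 2
      by_cases hx : x ∈ Ioo a b <;> simp [hx]
  simp only [heq] at hlim1
  exact tendsto_nhds_unique hlim1 hlim2

theorem inversionDensity_re_nonneg {μ : Measure ℝ} [IsFiniteMeasure μ]
    (h : Integrable (charFun μ)) (x : ℝ) : 0 ≤ (inversionDensity (charFun μ) x).re := by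
  by_contra! hx
  have hcont : Continuous fun x => (inversionDensity (charFun μ) x).re :=
    Complex.continuous_re.comp (continuous_inversionDensity h)
  obtain ⟨a, b, hmem, hsub⟩ := mem_nhds_iff_exists_Ioo_subset.1
    (hcont.continuousAt.eventually (Iio_mem_nhds hx))
  have hab : a < b := hmem.1.trans hmem.2
  have hpos := intervalIntegral.intervalIntegral_pos_of_pos_on (a := a) (b := b)
    (hcont.neg.intervalIntegrable _ _) (fun y hy => neg_pos.2 (hsub hy)) hab
  simp only [Pi.neg_apply] at hpos
  rw [intervalIntegral.integral_neg, intervalIntegral.integral_of_le hab.le,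
    integral_Ioc_eq_integral_Ioo, ← measureReal_Ioo_eq_integral_inversionDensity h] at hpos
  have := measureReal_nonneg (μ := μ) (s := Ioo a b)
  linarith

/-- Fourier inversion: a finite measure with integrable characteristic function has a density. -/
theorem eq_densityMeasure_inversionDensity {μ : Measure ℝ} [IsFiniteMeasure μ]
    (h : Integrable (charFun μ)) :
    μ = densityMeasure fun x => (inversionDensity (charFun μ) x).re := by
  have hcont : Continuous fun x => (inversionDensity (charFun μ) x).re :=
    Complex.continuous_re.comp (continuous_inversionDensity h)
  refine Real.measure_ext_Ioo_rat fun a b => ?_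
  have hint : IntegrableOn (fun x => (inversionDensity (charFun μ) x).re) (Ioo (a : ℝ) b) :=
    (hcont.integrableOn_Icc (a := (a : ℝ)) (b := b)).mono_set Ioo_subset_Icc_self
  rw [densityMeasure, withDensity_apply _ measurableSet_Ioo,
    ← ofReal_integral_eq_lintegral_ofReal hint
      (ae_of_all _ fun x => inversionDensity_re_nonneg h x),
    ← measureReal_Ioo_eq_integral_inversionDensity h, ofReal_measureReal]

theorem stableDensity_eq_inversionDensity (a η c : ℝ) :
    stableDensity a η c = fun x => (inversionDensity (stableCharFun a η c) x).re := rfl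

theorem continuous_stableDensity {a η c : ℝ} (h : Integrable (stableCharFun a η c)) :
    Continuous (stableDensity a η c) :=
  Complex.continuous_re.comp (continuous_inversionDensity h)

theorem stableDensity_nonneg {a η c : ℝ} (h : Integrable (stableCharFun a η c)) {ν : Measure ℝ}
    [IsFiniteMeasure ν] (hν : ∀ l, charFun ν l = stableCharFun a η c l) (x : ℝ) :
    0 ≤ stableDensity a η c x := by
  have hν' : charFun ν = stableCharFun a η c := funext hν
  rw [stableDensity_eq_inversionDensity, ← hν']
  exact inversionDensity_re_nonneg (hν' ▸ h) x

theorem eq_densityMeasure_stableDensity {a η c : ℝ} (h : Integrable (stableCharFun a η c))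
    {ν : Measure ℝ} [IsFiniteMeasure ν] (hν : ∀ l, charFun ν l = stableCharFun a η c l) :
    ν = densityMeasure (stableDensity a η c) := by
  have hν' : charFun ν = stableCharFun a η c := funext hν
  rw [stableDensity_eq_inversionDensity, ← hν']
  exact eq_densityMeasure_inversionDensity (hν' ▸ h)

/-! ### The hitting time of the stable subordinator -/

theorem stableCharFun_mul_scale {a η c s : ℝ} (ha : a ≠ 0) (hs : 0 < s) (l : ℝ) :
    stableCharFun a η (c * s) l = stableCharFun a η c (s ^ (1 / a) * l) := by
  have h0 : 0 < s ^ (1 / a) := by positivity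
  rw [stableCharFun, stableCharFun, abs_mul, abs_of_pos h0, mul_div_mul_left _ _ h0.ne',
    Real.mul_rpow h0.le (abs_nonneg l), ← Real.rpow_mul hs.le, one_div_mul_cancel ha,
    Real.rpow_one, ← mul_assoc]

theorem cos_pi_mul_div_two_pos {γ : ℝ} (hγ : 0 < γ) (hγ1 : γ < 1) : 0 < Real.cos (Real.pi * γ / 2) := by
  have := Real.pi_pos
  exact Real.cos_pos_of_mem_Ioo ⟨by nlinarith, by nlinarith⟩

theorem IsStableSubordinator.charFun_one {Ω : Type*} [MeasurableSpace Ω] {μ : Measure Ω}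
    {γ b : ℝ} {D : ℝ≥0 → Ω → ℝ} (hD : IsStableSubordinator γ b D μ)
    (l : ℝ) :
    charFun (μ.map (D 1)) l = stableCharFun γ γ b l := by
  rw [hD.stable.law, NNReal.coe_one, mul_one]

theorem hittingTime_nonneg {Ω : Type*} (D : ℝ≥0 → Ω → ℝ) (t : ℝ) (ω : Ω) : 0 ≤ hittingTime D t ω :=
  NNReal.coe_nonneg _

/-- A strict bound on the infimum yields some `y < x` with `D y > t`, and monotonicity carries this
to every `s n > y`; path regularity plays no role. Nonemptiness matters because `sInf ∅ = 0`. -/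
theorem hittingTime_lt_iff {Ω : Type*} {D : ℝ≥0 → Ω → ℝ} {t : ℝ} {ω : Ω}
    (hmono : Monotone fun s => D s ω)
    (hex : ∃ s : ℝ≥0, 0 < s ∧ t < D s ω) {x : ℝ≥0} {s : ℕ → ℝ≥0} (hs : ∀ n, 0 < s n)
    (hlt : ∀ n, s n < x) (hlim : Tendsto s atTop (𝓝 x)) :
    hittingTime D t ω < x ↔ ∃ n, t < D (s n) ω := by
  rw [hittingTime, NNReal.coe_lt_coe,
    csInf_lt_iff (s := {x : ℝ≥0 | 0 < x ∧ t < D x ω}) (OrderBot.bddBelow _) hex]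
  constructor
  · rintro ⟨y, ⟨-, hy⟩, hyx⟩
    obtain ⟨n, hn⟩ := (hlim.eventually (Ioi_mem_nhds hyx)).exists
    exact ⟨n, hy.trans_le (hmono (le_of_lt hn))⟩
  · rintro ⟨n, hn⟩
    exact ⟨s n, ⟨hs n, hn⟩, hlt n⟩

theorem hittingTime_preimage_Iio_of_nonpos {Ω : Type*} (D : ℝ≥0 → Ω → ℝ) (t : ℝ) {x : ℝ} (hx : x ≤ 0) :
    hittingTime D t ⁻¹' Iio x = ∅ := by
  ext ω
  simpa using hx.trans (hittingTime_nonneg D t ω)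

section Subordinator

variable {Ω : Type*} [MeasurableSpace Ω] {μ : Measure Ω} [IsProbabilityMeasure μ] {γ b : ℝ}
  {D : ℝ≥0 → Ω → ℝ}

theorem IsStableSubordinator.isProbabilityMeasure_map (hD : IsStableSubordinator γ b D μ)
    (s : ℝ≥0) : IsProbabilityMeasure (μ.map (D s)) :=
  Measure.isProbabilityMeasure_map (hD.stable.levy.aemeasurable s)

theorem IsStableSubordinator.map_one_eq (hD : IsStableSubordinator γ b D μ) (hγ : 0 < γ)
    (hγ1 : γ < 1) (hb : 0 < b) : μ.map (D 1) = densityMeasure (stableDensity γ γ b) :=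
  have := hD.isProbabilityMeasure_map 1
  eq_densityMeasure_stableDensity (integrable_stableCharFun hγ hb (cos_pi_mul_div_two_pos hγ hγ1))
    hD.charFun_one

theorem IsStableSubordinator.map_eq (hD : IsStableSubordinator γ b D μ) (hγ : 0 < γ) {s : ℝ≥0}
    (hs : 0 < s) : μ.map (D s) = (μ.map (D 1)).map (fun y => (s : ℝ) ^ (1 / γ) * y) := by
  have := hD.isProbabilityMeasure_map 1
  have := hD.isProbabilityMeasure_map s
  refine Measure.ext_of_charFun (funext fun l => ?_)
  rw [charFun_map_mul, hD.stable.law, hD.charFun_one,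
    stableCharFun_mul_scale hγ.ne' (NNReal.coe_pos.2 hs)]

theorem IsStableSubordinator.measure_lt (hD : IsStableSubordinator γ b D μ) (hγ : 0 < γ) {s : ℝ≥0}
    (hs : 0 < s) (t : ℝ) :
    μ {ω | t < D s ω} = μ.map (D 1) (Ioi (t * (s : ℝ) ^ (-(1 / γ)))) := by
  have hs' : (0 : ℝ) < s := NNReal.coe_pos.2 hs
  have h := Measure.map_apply_of_aemeasurable (hD.stable.levy.aemeasurable s)
    (measurableSet_Ioi (a := t))
  rw [hD.map_eq hγ hs, Measure.map_apply (by fun_prop) measurableSet_Ioi] at h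
  rw [show {ω | t < D s ω} = D s ⁻¹' Ioi t from rfl, ← h]
  congr 1
  ext y
  rw [mem_preimage, mem_Ioi, mem_Ioi, Real.rpow_neg hs'.le, ← div_eq_mul_inv,
    div_lt_iff₀ (by positivity), mul_comm y]

theorem IsStableSubordinator.map_one_Ioi_zero (hD : IsStableSubordinator γ b D μ) (hγ : 0 < γ)
    (hγ1 : γ < 1) (hb : 0 < b) : μ.map (D 1) (Ioi 0) = 1 := by
  have := hD.isProbabilityMeasure_map 1
  have h1 : μ.map (D 1) (Iio 0) = 0 := by
    rw [Measure.map_apply_of_aemeasurable (hD.stable.levy.aemeasurable 1) measurableSet_Iio]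
    have : ∀ᵐ ω ∂μ, ω ∉ D 1 ⁻¹' Iio 0 := by
      filter_upwards [hD.mono, hD.stable.levy.start_zero] with ω h h0
      rw [mem_preimage, mem_Iio, not_lt, ← h0]
      exact h zero_le_one
    simpa using measure_eq_zero_iff_ae_notMem.2 this
  have h2 : μ.map (D 1) {0} = 0 := by
    rw [hD.map_one_eq hγ hγ1 hb]
    exact withDensity_absolutelyContinuous _ _ (by simp)
  rw [← prob_compl_eq_zero_iff measurableSet_Ioi, compl_Ioi, ← Iio_union_right]
  exact measure_union_null h1 h2

theorem measure_iUnion_Ioi_eq {ν : Measure ℝ} {t : ℝ} {s : ℕ → ℝ} (hγ : 0 < γ) (ht : 0 < t)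
    (hs : ∀ n, 0 < s n) (hmono : Monotone s) :
    ν (⋃ n, Ioi (t * s n ^ (-(1 / γ)))) = ⨆ n, ν (Ioi (t * s n ^ (-(1 / γ)))) := by
  refine Monotone.measure_iUnion fun m n hmn => Ioi_subset_Ioi ?_
  have : -(1 / γ) ≤ 0 := by
    have : 0 < 1 / γ := by positivity
    linarith
  exact mul_le_mul_of_nonneg_left (Real.rpow_le_rpow_of_nonpos (hs m) (hmono hmn) this) ht.le

theorem IsStableSubordinator.measure_iUnion_lt (hD : IsStableSubordinator γ b D μ) (hγ : 0 < γ)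
    {t : ℝ} (ht : 0 < t) {s : ℕ → ℝ≥0} (hs : ∀ n, 0 < s n) (hmono : Monotone s) :
    μ (⋃ n, {ω | t < D (s n) ω}) = μ.map (D 1) (⋃ n, Ioi (t * (s n : ℝ) ^ (-(1 / γ)))) := by
  -- The events increase in `n` only along monotone paths. Intersecting with these changes each
  -- event by a null set and makes the sequence increasing.
  have h1 : (⋃ n, {ω | t < D (s n) ω} : Set Ω) =ᵐ[μ]
      (⋃ n, {ω | Monotone (fun s => D s ω) ∧ t < D (s n) ω} : Set Ω) := by
    filter_upwards [hD.mono] with ω h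
    refine propext ?_
    change ω ∈ (⋃ n, {ω | t < D (s n) ω}) ↔
      ω ∈ (⋃ n, {ω | Monotone (fun s => D s ω) ∧ t < D (s n) ω})
    simp [h]
  have h2 : ∀ n, μ {ω | Monotone (fun s => D s ω) ∧ t < D (s n) ω} = μ {ω | t < D (s n) ω} := by
    intro n
    refine measure_congr ?_
    filter_upwards [hD.mono] with ω h
    refine propext ?_
    change ω ∈ {ω | Monotone (fun s => D s ω) ∧ t < D (s n) ω} ↔ ω ∈ {ω | t < D (s n) ω}
    simp [h]
  rw [measure_congr h1, Monotone.measure_iUnion, measure_iUnion_Ioi_eq hγ ht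
    (fun n => NNReal.coe_pos.2 (hs n)) (fun m n h => NNReal.coe_le_coe.2 (hmono h))]
  · simp only [h2, hD.measure_lt hγ (hs _)]
  · exact fun m n hmn ω hω => ⟨hω.1, hω.2.trans_le (hω.1 (hmono hmn))⟩

theorem iUnion_Ioi_mul_rpow {t : ℝ} (ht : 0 < t) {s : ℕ → ℝ} {x : ℝ} (hx : 0 < x)
    (hγ : 0 < γ) (hs : ∀ n, 0 < s n) (hlt : ∀ n, s n < x) (hlim : Tendsto s atTop (𝓝 x)) :
    ⋃ n, Ioi (t * s n ^ (-(1 / γ))) = Ioi (t * x ^ (-(1 / γ))) := by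
  have hγ' : 0 < 1 / γ := by positivity
  apply Subset.antisymm
  · refine iUnion_subset fun n => Ioi_subset_Ioi ?_
    exact mul_le_mul_of_nonneg_left
      (Real.rpow_le_rpow_of_nonpos (hs n) (hlt n).le (by linarith)) ht.le
  · intro y (hy : _ < y)
    have : Tendsto (fun n => t * s n ^ (-(1 / γ))) atTop (𝓝 (t * x ^ (-(1 / γ)))) :=
      (hlim.rpow_const (Or.inl hx.ne')).const_mul t
    obtain ⟨n, hn⟩ := (this.eventually (Iio_mem_nhds hy)).exists
    exact mem_iUnion.2 ⟨n, hn⟩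

/-- By self-similarity the probability that `D` exceeds `t` at some positive integer time is that of
`D 1 > 0`, which is one. -/
theorem IsStableSubordinator.ae_exists_lt (hD : IsStableSubordinator γ b D μ) (hγ : 0 < γ)
    (hγ1 : γ < 1) (hb : 0 < b) {t : ℝ} (ht : 0 < t) :
    ∀ᵐ ω ∂μ, ∃ s : ℝ≥0, 0 < s ∧ t < D s ω := by
  have h := hD.measure_iUnion_lt hγ ht (s := fun n => (n + 1 : ℕ)) (fun n => by positivity)
    (fun m n h => by simpa using h)
  have hU : ⋃ n : ℕ, Ioi (t * (((n + 1 : ℕ) : ℝ≥0) : ℝ) ^ (-(1 / γ))) = Ioi 0 := by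
    apply Subset.antisymm
    · exact iUnion_subset fun n => Ioi_subset_Ioi (by positivity)
    · intro y (hy : 0 < y)
      have h1 : Tendsto (fun n : ℕ => t * (((n + 1 : ℕ) : ℝ≥0) : ℝ) ^ (-(1 / γ))) atTop (𝓝 0) := by
        have := ((tendsto_rpow_neg_atTop (by positivity : 0 < 1 / γ)).comp
          ((tendsto_natCast_atTop_atTop (R := ℝ)).comp (tendsto_add_atTop_nat 1))).const_mul t
        simpa using this
      obtain ⟨n, hn⟩ := (h1.eventually (Iio_mem_nhds hy)).exists
      exact mem_iUnion.2 ⟨n, hn⟩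
  rw [hU, hD.map_one_Ioi_zero hγ hγ1 hb] at h
  have hmeas : NullMeasurableSet (⋃ n : ℕ, {ω | t < D ((n + 1 : ℕ) : ℝ≥0) ω}) μ :=
    NullMeasurableSet.iUnion fun n => nullMeasurableSet_lt aemeasurable_const
      (hD.stable.levy.aemeasurable _)
  filter_upwards [(mem_ae_iff_prob_eq_one₀ hmeas).2 h] with ω hω
  obtain ⟨n, hn⟩ := mem_iUnion.1 hω
  exact ⟨_, by positivity, hn⟩

theorem exists_seq_tendsto_from_below {x : ℝ≥0} (hx : 0 < x) :
    ∃ s : ℕ → ℝ≥0, Monotone s ∧ (∀ n, 0 < s n) ∧ (∀ n, s n < x) ∧ Tendsto s atTop (𝓝 x) := by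
  obtain ⟨s, h1, h2, h3⟩ := exists_seq_strictMono_tendsto' hx
  exact ⟨s, h1.monotone, fun n => (h2 n).1, fun n => (h2 n).2, h3⟩

theorem IsStableSubordinator.hittingTime_lt_ae_eq (hD : IsStableSubordinator γ b D μ) (hγ : 0 < γ)
    (hγ1 : γ < 1) (hb : 0 < b) {t : ℝ} (ht : 0 < t) {x : ℝ≥0} {s : ℕ → ℝ≥0} (hs : ∀ n, 0 < s n)
    (hlt : ∀ n, s n < x) (hlim : Tendsto s atTop (𝓝 x)) :
    hittingTime D t ⁻¹' Iio (x : ℝ) =ᵐ[μ] ⋃ n, {ω | t < D (s n) ω} := by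
  filter_upwards [hD.mono, hD.ae_exists_lt hγ hγ1 hb ht] with ω h1 h2
  refine propext ?_
  change hittingTime D t ω < x ↔ ω ∈ ⋃ n, {ω | t < D (s n) ω}
  rw [hittingTime_lt_iff h1 h2 hs hlt hlim]
  simp

theorem IsStableSubordinator.aemeasurable_hittingTime (hD : IsStableSubordinator γ b D μ)
    (hγ : 0 < γ) (hγ1 : γ < 1) (hb : 0 < b) {t : ℝ} (ht : 0 < t) :
    AEMeasurable (hittingTime D t) μ := by
  refine NullMeasurable.aemeasurable ?_
  -- The events agree with measurable ones only up to null sets, so measurability is shown for the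
  -- completed σ-algebra.
  have : @Measurable (NullMeasurableSpace Ω μ) ℝ _ _ (hittingTime D t) := by
    refine measurable_of_Iio fun x => ?_
    rcases le_or_gt x 0 with hx | hx
    · have h := hittingTime_preimage_Iio_of_nonpos D t hx
      exact h ▸ MeasurableSet.empty
    · lift x to ℝ≥0 using hx.le
      obtain ⟨s, -, h2, h3, h4⟩ := exists_seq_tendsto_from_below (NNReal.coe_pos.1 hx)
      have hmeas : NullMeasurableSet (⋃ n : ℕ, {ω | t < D (s n) ω}) μ :=
        NullMeasurableSet.iUnion fun n => nullMeasurableSet_lt aemeasurable_const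
          (hD.stable.levy.aemeasurable _)
      exact hmeas.congr (hD.hittingTime_lt_ae_eq hγ hγ1 hb ht h2 h3 h4).symm
  exact fun s hs => this hs

theorem IsStableSubordinator.measure_hittingTime_lt (hD : IsStableSubordinator γ b D μ)
    (hγ : 0 < γ) (hγ1 : γ < 1) (hb : 0 < b) {t : ℝ} (ht : 0 < t) {x : ℝ} (hx : 0 < x) :
    μ (hittingTime D t ⁻¹' Iio x) = μ.map (D 1) (Ioi (t * x ^ (-(1 / γ)))) := by
  lift x to ℝ≥0 using hx.le
  obtain ⟨s, h1, h2, h3, h4⟩ := exists_seq_tendsto_from_below (NNReal.coe_pos.1 hx)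
  rw [measure_congr (hD.hittingTime_lt_ae_eq hγ hγ1 hb ht h2 h3 h4),
    hD.measure_iUnion_lt hγ ht h2 h1, iUnion_Ioi_mul_rpow ht hx hγ
      (fun n => NNReal.coe_pos.2 (h2 n)) (fun n => NNReal.coe_lt_coe.2 (h3 n))
      (NNReal.tendsto_coe.2 h4)]

theorem image_mul_rpow_neg {a t x : ℝ} (ha : 0 < a) (ht : 0 < t) (hx : 0 < x) :
    (fun y => t * y ^ (-a)) '' Ioo 0 x = Ioi (t * x ^ (-a)) := by
  ext z
  simp only [mem_image, mem_Ioo, mem_Ioi]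
  constructor
  · rintro ⟨y, ⟨hy, hyx⟩, rfl⟩
    exact mul_lt_mul_of_pos_left (Real.rpow_lt_rpow_of_neg hy hyx (by linarith)) ht
  · intro hz
    have hz0 : 0 < z := lt_trans (by positivity) hz
    refine ⟨(z / t) ^ (-(1 / a)), ⟨by positivity, ?_⟩, ?_⟩
    · have h1 : x ^ (-a) < z / t := by
        rw [lt_div_iff₀ ht]
        linarith
      have h2 := Real.rpow_lt_rpow_of_neg (by positivity) h1
        (neg_lt_zero.2 (by positivity : 0 < 1 / a))
      rwa [← Real.rpow_mul hx.le, neg_mul_neg, mul_one_div_cancel ha.ne', Real.rpow_one] at h2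
    · rw [← Real.rpow_mul (by positivity), neg_mul_neg, one_div_mul_cancel ha.ne', Real.rpow_one]
      field_simp

/-- Change of variables `z = t * y ^ (-(1 / γ))`, whose Jacobian is the prefactor in the formula for
`h`. -/
theorem lintegral_inverseStableFormula (hγ : 0 < γ) {t x : ℝ} (ht : 0 < t) (hx : 0 < x) :
    ∫⁻ y in Ioo 0 x, ENNReal.ofReal (inverseStableFormula γ b y t) =
      ∫⁻ z in Ioi (t * x ^ (-(1 / γ))), ENNReal.ofReal (stableDensity γ γ b z) := by
  have hγ' : 0 < 1 / γ := by positivity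
  have hderiv : ∀ y ∈ Ioo 0 x, HasDerivWithinAt (fun y => t * y ^ (-(1 / γ)))
      (t * (-(1 / γ) * y ^ (-(1 / γ) - 1))) (Ioo 0 x) y := fun y hy =>
    ((Real.hasDerivAt_rpow_const (Or.inl hy.1.ne')).const_mul t).hasDerivWithinAt
  have hinj : InjOn (fun y => t * y ^ (-(1 / γ))) (Ioo 0 x) := by
    refine StrictAntiOn.injOn fun y hy z _ hyz => ?_
    exact mul_lt_mul_of_pos_left (Real.rpow_lt_rpow_of_neg hy.1 hyz (by linarith)) ht
  rw [← image_mul_rpow_neg hγ' ht hx,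
    lintegral_image_eq_lintegral_abs_deriv_mul measurableSet_Ioo hderiv hinj]
  refine setLIntegral_congr_fun measurableSet_Ioo fun y hy => ?_
  have hy0 : 0 < y := hy.1
  have hpow : 0 < y ^ (-1 - 1 / γ) := by positivity
  have habs : |t * (-(1 / γ) * y ^ (-(1 / γ) - 1))| = t / γ * y ^ (-1 - 1 / γ) := by
    rw [show -(1 / γ) - 1 = -1 - 1 / γ by ring, show t * (-(1 / γ) * y ^ (-1 - 1 / γ)) =
      -(t / γ * y ^ (-1 - 1 / γ)) by ring, abs_neg, abs_of_pos (by positivity)]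
  rw [habs, ← ENNReal.ofReal_mul (by positivity), inverseStableFormula]

theorem densityMeasure_inverseStableDensity_Iio (t x : ℝ) :
    densityMeasure (fun x => inverseStableDensity γ b x t) (Iio x) =
      ∫⁻ y in Ioo 0 x, ENNReal.ofReal (inverseStableFormula γ b y t) := by
  rw [densityMeasure, withDensity_apply _ measurableSet_Iio]
  have hzero : ∀ᵐ y : ℝ, y ≠ 0 := by simp [ae_iff]
  have : Ioo 0 x = Ioi 0 ∩ Iio x := rfl
  rw [this, ← setLIntegral_indicator measurableSet_Ioi]
  refine lintegral_congr_ae (ae_restrict_of_ae ?_)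
  filter_upwards [hzero] with y hy
  by_cases h : 0 < y
  · simp [inverseStableDensity, h]
  · simp [inverseStableDensity, h, hy]

theorem IsStableSubordinator.hasLaw_hittingTime (hD : IsStableSubordinator γ b D μ)
    (hγ : 0 < γ) (hγ1 : γ < 1) (hb : 0 < b) {t : ℝ} (ht : 0 < t) :
    HasLaw (hittingTime D t) (densityMeasure fun x => inverseStableDensity γ b x t) μ := by
  have hmeas := hD.aemeasurable_hittingTime hγ hγ1 hb ht
  have := Measure.isProbabilityMeasure_map hmeas
  refine ⟨hmeas, ?_⟩
  refine Measure.ext_of_generateFrom_of_iUnion (range Iio) (fun n : ℕ => Iio (n : ℝ)) ?_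
    isPiSystem_Iio ?_ (fun n => mem_range_self _) (fun n => measure_ne_top _ _) ?_
  · rw [← borel_eq_generateFrom_Iio]
    exact BorelSpace.measurable_eq
  · ext x
    simpa using exists_nat_gt x
  · rintro _ ⟨x, rfl⟩
    rw [Measure.map_apply_of_aemeasurable hmeas measurableSet_Iio,
      densityMeasure_inverseStableDensity_Iio]
    rcases le_or_gt x 0 with hx | hx
    · rw [hittingTime_preimage_Iio_of_nonpos D t hx, Ioo_eq_empty (not_lt.2 hx)]
      simp
    · rw [hD.measure_hittingTime_lt hγ hγ1 hb ht hx, lintegral_inverseStableFormula hγ ht hx,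
        hD.map_one_eq hγ hγ1 hb, densityMeasure, withDensity_apply _ measurableSet_Ioi]

end Subordinator

/-! ### Sector integrals and their fractional derivatives -/

/-- The integral `(2 π I)⁻¹ ∫ z ^ β * exp (c z ^ α - x z) dz` over the boundary of the sector
`|arg z| < θ`. -/
noncomputable def sectorIntegral (α β c θ x : ℝ) : ℝ := Real.pi⁻¹ * (rayIntegral α β c x θ).im

section SectorIntegral

variable {α β c θ : ℝ}

theorem hasDerivAt_sectorIntegral (hα : 1 < α) (hβ : -1 < β) (hc : 0 < c)
    (hθ : Real.cos (α * θ) < 0) (x : ℝ) :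
    HasDerivAt (sectorIntegral α β c θ) (-sectorIntegral α (β + 1) c θ x) x := by
  have := (Complex.imCLM.hasFDerivAt.comp_hasDerivAt x
    (hasDerivAt_rayIntegral_pos hα hβ hc hθ x)).const_mul Real.pi⁻¹
  simpa [sectorIntegral, Function.comp_def] using! this

theorem hasDerivAt_sectorIntegral_scale (hα : 1 < α) (hβ : -1 < β) (hc : 0 < c)
    (hθ : Real.cos (α * θ) < 0) (x : ℝ) :
    HasDerivAt (fun c => sectorIntegral α β c θ x) (sectorIntegral α (β + α) c θ x) c := by
  have := (Complex.imCLM.hasFDerivAt.comp_hasDerivAt c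
    (hasDerivAt_rayIntegral_scale hα hβ hc hθ x)).const_mul Real.pi⁻¹
  simpa [sectorIntegral, Function.comp_def] using! this

theorem deriv_sectorIntegral (hα : 1 < α) (hβ : -1 < β) (hc : 0 < c)
    (hθ : Real.cos (α * θ) < 0) :
    deriv (sectorIntegral α β c θ) = -sectorIntegral α (β + 1) c θ :=
  funext fun x => (hasDerivAt_sectorIntegral hα hβ hc hθ x).deriv

theorem differentiable_sectorIntegral (hα : 1 < α) (hβ : -1 < β) (hc : 0 < c)
    (hθ : Real.cos (α * θ) < 0) : Differentiable ℝ (sectorIntegral α β c θ) :=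
  fun x => (hasDerivAt_sectorIntegral hα hβ hc hθ x).differentiableAt

theorem contDiff_sectorIntegral (hα : 1 < α) (hβ : -1 < β) (hc : 0 < c)
    (hθ : Real.cos (α * θ) < 0) (n : ℕ) : ContDiff ℝ n (sectorIntegral α β c θ) := by
  induction n generalizing β with
  | zero => exact contDiff_zero.2 (differentiable_sectorIntegral hα hβ hc hθ).continuous
  | succ n ih =>
    push_cast
    refine contDiff_succ_iff_deriv.2 ⟨differentiable_sectorIntegral hα hβ hc hθ, by simp, ?_⟩
    rw [deriv_sectorIntegral hα hβ hc hθ]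
    exact (ih (by linarith)).neg

theorem iteratedDeriv_sectorIntegral (hα : 1 < α) (hβ : -1 < β) (hc : 0 < c)
    (hθ : Real.cos (α * θ) < 0) (n : ℕ) :
    iteratedDeriv n (sectorIntegral α β c θ) =
      fun x => (-1) ^ n * sectorIntegral α (β + n) c θ x := by
  induction n generalizing β with
  | zero => simp
  | succ n ih =>
    rw [iteratedDeriv_succ', deriv_sectorIntegral hα hβ hc hθ]
    ext x
    rw [iteratedDeriv_neg, ih (by linarith)]
    push_cast
    ring_nf

theorem integral_sectorIntegral_mul_rpow {s : ℝ} (x : ℝ) (hα : 1 < α) (hβ : -1 < β - s)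
    (hc : 0 < c) (hαθ : Real.cos (α * θ) < 0) (hθ : 0 ≤ θ) (hθ' : θ < Real.pi / 2) (hs : 0 < s) :
    IntegrableOn (fun y => sectorIntegral α β c θ y * (y - x) ^ (s - 1)) (Ioi x) ∧
    ∫ y in Ioi x, sectorIntegral α β c θ y * (y - x) ^ (s - 1) =
      Real.Gamma s * sectorIntegral α (β - s) c θ x := by
  obtain ⟨h1, h2⟩ := integral_rayIntegral_mul_rpow x hα hβ hc hαθ hθ hθ' hs
  have h3 : ∀ y, sectorIntegral α β c θ y * (y - x) ^ (s - 1) =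
      Real.pi⁻¹ * RCLike.im (rayIntegral α β c y θ * (((y - x) ^ (s - 1) : ℝ) : ℂ)) := by
    intro y
    rw [sectorIntegral, RCLike.im_eq_complex_im, Complex.im_mul_ofReal, mul_assoc]
  simp only [h3]
  refine ⟨h1.im.const_mul _, ?_⟩
  rw [integral_const_mul, integral_im h1, h2, RCLike.im_eq_complex_im, Complex.im_ofReal_mul,
    sectorIntegral]
  ring

theorem abs_sectorIntegral_le (hβ : -1 < β) (hc : 0 ≤ c) (hαθ : Real.cos (α * θ) ≤ 0)
    (hθ : 0 < Real.cos θ) {x : ℝ} (hx : 0 < x) :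
    |sectorIntegral α β c θ x| ≤
      Real.pi⁻¹ * (Real.Gamma (β + 1) * (Real.cos θ)⁻¹ ^ (β + 1)) * x ^ (-(β + 1)) := by
  have := Real.pi_pos
  rw [sectorIntegral, abs_mul, abs_of_pos (by positivity), mul_assoc]
  gcongr
  exact (Complex.abs_im_le_norm _).trans (norm_rayIntegral_le hβ hc hx hαθ hθ)

theorem tendsto_sectorIntegral_atTop (hβ : -1 < β) (hc : 0 ≤ c) (hαθ : Real.cos (α * θ) ≤ 0)
    (hθ : 0 < Real.cos θ) : Tendsto (sectorIntegral α β c θ) atTop (𝓝 0) := by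
  have h := (tendsto_rpow_neg_atTop (by linarith : 0 < β + 1)).const_mul
    (Real.pi⁻¹ * (Real.Gamma (β + 1) * (Real.cos θ)⁻¹ ^ (β + 1)))
  rw [mul_zero] at h
  refine squeeze_zero_norm' ?_ h
  filter_upwards [eventually_gt_atTop 0] with x hx
  exact abs_sectorIntegral_le hβ hc hαθ hθ hx

theorem integrableOn_sectorIntegral (hα : 1 < α) (hβ : 0 < β) (hc : 0 < c)
    (hαθ : Real.cos (α * θ) < 0) (hθ : 0 < Real.cos θ) :
    IntegrableOn (sectorIntegral α β c θ) (Ioi 0) := by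
  have hcont : Continuous (sectorIntegral α β c θ) :=
    (differentiable_sectorIntegral hα (by linarith) hc hαθ).continuous
  rw [← Ioc_union_Ioi_eq_Ioi (zero_le_one' ℝ)]
  refine (hcont.integrableOn_Icc.mono_set Ioc_subset_Icc_self).union ?_
  refine ((integrableOn_Ioi_rpow_of_lt (by linarith : -(β + 1) < -1) one_pos).const_mul
    (Real.pi⁻¹ * (Real.Gamma (β + 1) * (Real.cos θ)⁻¹ ^ (β + 1)))).mono'
    hcont.aestronglyMeasurable ?_
  filter_upwards [ae_restrict_mem measurableSet_Ioi] with x (hx : 1 < x)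
  exact abs_sectorIntegral_le (by linarith) hc.le hαθ.le hθ (by linarith)

theorem integral_Ioi_sectorIntegral (hα : 1 < α) (hβ : -1 < β) (hβ' : 0 < β + 1) (hc : 0 < c)
    (hαθ : Real.cos (α * θ) < 0) (hθ : 0 < Real.cos θ) :
    ∫ x in Ioi (0 : ℝ), sectorIntegral α (β + 1) c θ x = sectorIntegral α β c θ 0 := by
  have := integral_Ioi_of_hasDerivAt_of_tendsto' (a := 0)
    (fun x _ => hasDerivAt_sectorIntegral hα hβ hc hαθ x)
    (integrableOn_sectorIntegral hα hβ' hc hαθ hθ).neg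
    (tendsto_sectorIntegral_atTop hβ hc.le hαθ.le hθ)
  rw [integral_neg, zero_sub] at this
  exact neg_injective this

/-- At `x = 0` the integrand is an exact derivative up to the real factor `c * α`, so the ray
integral is real. -/
theorem sectorIntegral_sub_one_zero (hα : 1 < α) (hc : 0 < c) (hαθ : Real.cos (α * θ) < 0) :
    sectorIntegral α (α - 1) c θ 0 = 0 := by
  obtain ⟨M, hM⟩ := exists_ray_exponent_le hα hc hαθ 0
  have := rayIntegral_relation (α := α) (c := c) (x := 0) (θ := θ) (by linarith) one_pos
    fun r hr => hM c 0 r le_rfl (by simp) hr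
  have h2 := congrArg Complex.im this
  rw [Complex.ofReal_zero, zero_mul, sub_zero, ← Complex.ofReal_mul, Complex.im_ofReal_mul,
    Complex.neg_im, Complex.one_im, neg_zero] at h2
  have h3 : c * α ≠ 0 := by positivity
  rw [sectorIntegral, (mul_eq_zero.1 h2).resolve_left h3, mul_zero]

/-- Order `s` inserts `z ^ (-s)`, integrable at the origin because `s < 1`. Only arguments at or
above `x ≥ 0` enter, so `f` may be arbitrary on the negative axis. -/
theorem negFracIntegral_of_eqOn {f : ℝ → ℝ} {k s : ℝ} (hα : 1 < α) (hc : 0 < c)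
    (hαθ : Real.cos (α * θ) < 0) (hθ : 0 ≤ θ) (hθ' : θ < Real.pi / 2)
    (hf : ∀ x, 0 ≤ x → f x = k * sectorIntegral α 0 c θ x) (hs : 0 ≤ s) (hs1 : s < 1) {x : ℝ}
    (hx : 0 ≤ x) :
    (0 < s → IntegrableOn (fun y => f y * (y - x) ^ (s - 1)) (Ioi x)) ∧
      negFracIntegral s f x = k * sectorIntegral α (-s) c θ x := by
  rcases hs.eq_or_lt with rfl | hs
  · simp [negFracIntegral, hf x hx]
  · obtain ⟨h1, h2⟩ := integral_sectorIntegral_mul_rpow (β := 0) x hα (by linarith) hc hαθ hθ hθ' hs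
    have heq : ∀ y ∈ Ioi x, f y * (y - x) ^ (s - 1) =
        k * (sectorIntegral α 0 c θ y * (y - x) ^ (s - 1)) := by
      intro y (hy : x < y)
      rw [hf y (by linarith), mul_assoc]
    refine ⟨fun _ => IntegrableOn.congr_fun (h1.const_mul k) (fun y hy => (heq y hy).symm)
      measurableSet_Ioi, ?_⟩
    have hΓ := (Real.Gamma_pos_of_pos hs).ne'
    rw [negFracIntegral, if_neg hs.ne', setIntegral_congr_fun measurableSet_Ioi heq,
      integral_const_mul, h2, zero_sub]
    field_simp

/-- The negative Riemann-Liouville derivatives of a function which is given by a sector integral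
on the half-line `[0, ∞)`. -/
theorem hasContNegRLDeriv_of_eqOn {f : ℝ → ℝ} {k r : ℝ} (hα : 1 < α) (hc : 0 < c)
    (hαθ : Real.cos (α * θ) < 0) (hθ : 0 ≤ θ) (hθ' : θ < Real.pi / 2)
    (hf : ∀ x, 0 ≤ x → f x = k * sectorIntegral α 0 c θ x) (hr : 0 < r) :
    HasContNegRLDeriv r f ∧ ∀ x, 0 ≤ x → negRLDeriv r f x = k * sectorIntegral α r c θ x := by
  have hs : 0 ≤ (⌈r⌉₊ : ℝ) - r := sub_nonneg.2 (Nat.le_ceil r)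
  have hs1 : (⌈r⌉₊ : ℝ) - r < 1 := by
    have := Nat.ceil_lt_add_one hr.le
    linarith
  have hfrac := fun x hx => negFracIntegral_of_eqOn (x := x) hα hc hαθ hθ hθ' hf hs hs1 hx
  have heq : EqOn (negFracIntegral (⌈r⌉₊ - r) f)
      (fun x => k * sectorIntegral α (-(⌈r⌉₊ - r)) c θ x) (Ici 0) := fun x hx => (hfrac x hx).2
  have hβ : -1 < -((⌈r⌉₊ : ℝ) - r) := by linarith
  have hsmooth := contDiff_sectorIntegral (c := c) (θ := θ) hα hβ hc hαθ ⌈r⌉₊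
  refine ⟨⟨fun h x hx => (hfrac x hx).1 (sub_pos.2 h), ?_⟩, fun x hx => ?_⟩
  · exact (contDiff_const.mul hsmooth).contDiffOn.congr heq
  -- One-sided derivatives agree with those of the sector integral, which is smooth on the whole
  -- line. The exponents add up to `r`, and the two signs cancel.
  · rw [negRLDeriv, iteratedDerivWithin_congr heq hx,
      iteratedDerivWithin_eq_iteratedDeriv (uniqueDiffOn_Ici 0)
        (contDiff_const.mul hsmooth).contDiffAt hx,
      iteratedDeriv_const_mul_field, iteratedDeriv_sectorIntegral hα hβ hc hαθ]
    have : -((⌈r⌉₊ : ℝ) - r) + ⌈r⌉₊ = r := by ring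
    simp only [this]
    rw [mul_left_comm, ← mul_assoc ((-1) ^ _), ← mul_pow]
    simp

end SectorIntegral

/-! ### The inverse stable density and the boundary value problem -/

theorem inverseStableFormula_eq {γ α b t x : ℝ} (hγ : 1 / 2 ≤ γ) (hγ1 : γ < 1) (hα : α = 1 / γ)
    (hb : 0 < b) (ht : 0 < t) (hx : 0 < x) :
    inverseStableFormula γ b x t = α * stableDensity α (2 - α) (b ^ (-α) * t) x := by
  rw [stableDensity_duality hγ hγ1 hα hb ht hx, inverseStableFormula, ← hα]
  have : t / γ = α * t := by rw [hα]; ring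
  rw [this]
  ring

theorem integrable_stableCharFun_spectrallyNegative {α c : ℝ} (hα : 1 < α) (hα2 : α ≤ 2)
    (hc : 0 < c) : Integrable (stableCharFun α (2 - α) c) :=
  integrable_stableCharFun (by linarith) hc (cos_pi_mul_two_sub_div_two_pos hα hα2)

/-- Duality covers `x > 0`; at `x = 0` continuity of the stable density shows that the defining
limit exists and has the right value. -/
theorem inverseStableDensity_eq {γ α b t x : ℝ} (hγ : 1 / 2 ≤ γ) (hγ1 : γ < 1) (hα : α = 1 / γ)
    (hb : 0 < b) (ht : 0 < t) (hx : 0 ≤ x) :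
    inverseStableDensity γ b x t = α * stableDensity α (2 - α) (b ^ (-α) * t) x := by
  have hγ0 : 0 < γ := by linarith
  have hα1 : 1 < α := by rw [hα, lt_div_iff₀ hγ0]; linarith
  have hα2 : α ≤ 2 := by rw [hα, div_le_iff₀ hγ0]; linarith
  rcases hx.eq_or_lt with rfl | hx
  · have hcont := continuous_stableDensity (integrable_stableCharFun_spectrallyNegative hα1 hα2
      (by positivity : 0 < b ^ (-α) * t))
    rw [inverseStableDensity, if_neg (lt_irrefl _), if_pos rfl]
    refine Tendsto.limUnder_eq (Tendsto.congr' (f₁ := fun x =>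
      α * stableDensity α (2 - α) (b ^ (-α) * t) x) ?_
      ((hcont.tendsto 0).const_mul α |>.mono_left nhdsWithin_le_nhds))
    filter_upwards [self_mem_nhdsWithin] with y hy
    exact (inverseStableFormula_eq hγ hγ1 hα hb ht hy).symm
  · rw [inverseStableDensity, if_pos hx, inverseStableFormula_eq hγ hγ1 hα hb ht hx]

/-- The law of `X` is a probability measure whose density vanishes on the negative axis. This
normalization is the source of the mass `1 / α`. -/
theorem integral_Ioi_inverseStableDensity {Ω : Type*} [MeasurableSpace Ω] {μ : Measure Ω}
    [IsProbabilityMeasure μ] {X : Ω → ℝ} {γ b t : ℝ}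
    (hX : HasLaw X (densityMeasure fun x => inverseStableDensity γ b x t) μ)
    (hnonneg : ∀ x, 0 ≤ inverseStableDensity γ b x t)
    (hcont : ContinuousOn (fun x => inverseStableDensity γ b x t) (Ici 0)) :
    IntegrableOn (fun x => inverseStableDensity γ b x t) (Ioi 0) ∧
      ∫ x in Ioi (0 : ℝ), inverseStableDensity γ b x t = 1 := by
  have hprob := Measure.isProbabilityMeasure_map hX.aemeasurable
  rw [hX.map_eq] at hprob
  have h1 : ∫⁻ x in Ioi (0 : ℝ), ENNReal.ofReal (inverseStableDensity γ b x t) = 1 := by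
    have := hprob.measure_univ
    rw [densityMeasure, withDensity_apply _ MeasurableSet.univ, Measure.restrict_univ] at this
    rw [← this, ← lintegral_indicator measurableSet_Ioi]
    refine lintegral_congr_ae ?_
    have hzero : ∀ᵐ y : ℝ, y ≠ 0 := by simp [ae_iff]
    filter_upwards [hzero] with y hy
    by_cases h : 0 < y
    · simp [h]
    · simp [inverseStableDensity, h, hy]
  have hmeas : AEStronglyMeasurable (fun x => inverseStableDensity γ b x t)
      (volume.restrict (Ioi 0)) :=
    (hcont.mono Ioi_subset_Ici_self).aestronglyMeasurable measurableSet_Ioi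
  have hae : 0 ≤ᵐ[volume.restrict (Ioi 0)] fun x => inverseStableDensity γ b x t :=
    ae_of_all _ hnonneg
  refine ⟨⟨hmeas, ?_⟩, ?_⟩
  · rw [hasFiniteIntegral_iff_ofReal hae, h1]
    exact ENNReal.one_lt_top
  · rw [integral_eq_lintegral_of_nonneg_ae hae hmeas, h1, ENNReal.toReal_one]

theorem theorem5p1 {Ω : Type*} [MeasurableSpace Ω] (μ : Measure Ω) [IsProbabilityMeasure μ]
    (γ α b : ℝ) (hγ : 1 / 2 ≤ γ) (hγ1 : γ < 1) (hα : α = 1 / γ) (hb : 0 < b)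
    (D : ℝ≥0 → Ω → ℝ) (hD : IsStableSubordinator γ b D μ) :
    -- `D(1)` has the density `p_γ(x; γ, b)`, and `E_t` has the density `h(x, t)`
    ((∀ x : ℝ, 0 ≤ stableDensity γ γ b x) ∧
      HasLaw (D 1) (densityMeasure (stableDensity γ γ b)) μ) ∧
    (∀ t : ℝ, 0 < t →
      (∀ x : ℝ, 0 ≤ inverseStableDensity γ b x t) ∧
      ContinuousOn (fun x => inverseStableDensity γ b x t) (Ici 0) ∧
      HasLaw (hittingTime D t) (densityMeasure fun x => inverseStableDensity γ b x t) μ) ∧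
    -- the fractional derivatives of `h(·, t)` of orders `α` and `α - 1` exist on `[0, ∞)`
    (∀ t : ℝ, 0 < t →
      HasContNegRLDeriv α (fun x => inverseStableDensity γ b x t) ∧
      HasContNegRLDeriv (α - 1) (fun x => inverseStableDensity γ b x t)) ∧
    -- the equation on `x > 0`
    (∀ t : ℝ, 0 < t → ∀ x : ℝ, 0 < x →
      HasDerivAt (fun s => inverseStableDensity γ b x s)
        (b ^ (-α) * negRLDeriv α (fun y => inverseStableDensity γ b y t) x) t) ∧
    -- the boundary condition at `x = 0`
    (∀ t : ℝ, 0 < t → negRLDeriv (α - 1) (fun y => inverseStableDensity γ b y t) 0 = 0) ∧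
    -- the stable Lévy motion `Y(t)` with density `P(x, t) = p_α(x; 2 - α, b^(-α) t)` keeps the
    -- mass `1 / α` on the positive half-line
    (∀ (Ω' : Type*) [MeasurableSpace Ω'] (μ' : Measure Ω') [IsProbabilityMeasure μ']
      (Y : ℝ≥0 → Ω' → ℝ), IsStableLevyMotion α (2 - α) (b ^ (-α)) Y μ' →
      ∀ t : ℝ≥0, 0 < t →
        HasLaw (Y t) (densityMeasure (stableDensity α (2 - α) (b ^ (-α) * t))) μ' ∧
        μ'.real {ω | 0 < Y t ω} = 1 / α) ∧
    -- the rate of change of this mass is the boundary value of the derivative of order `α - 1`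
    (∀ t : ℝ, 0 < t →
      IntegrableOn (fun x => stableDensity α (2 - α) (b ^ (-α) * t) x) (Ioi 0) ∧
      ∫ x in Ioi (0 : ℝ), stableDensity α (2 - α) (b ^ (-α) * t) x = 1 / α ∧
      HasContNegRLDeriv α (stableDensity α (2 - α) (b ^ (-α) * t)) ∧
      HasContNegRLDeriv (α - 1) (stableDensity α (2 - α) (b ^ (-α) * t)) ∧
      IntegrableOn (negRLDeriv α (stableDensity α (2 - α) (b ^ (-α) * t))) (Ioi 0) ∧
      HasDerivAt (fun s => ∫ x in Ioi (0 : ℝ), stableDensity α (2 - α) (b ^ (-α) * s) x)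
        (b ^ (-α) * ∫ x in Ioi (0 : ℝ), negRLDeriv α (stableDensity α (2 - α) (b ^ (-α) * t)) x)
        t ∧
      ∫ x in Ioi (0 : ℝ), negRLDeriv α (stableDensity α (2 - α) (b ^ (-α) * t)) x =
        negRLDeriv (α - 1) (stableDensity α (2 - α) (b ^ (-α) * t)) 0) := by
  have hγ0 : 0 < γ := by linarith
  have hα1 : 1 < α := by rw [hα, lt_div_iff₀ hγ0]; linarith
  have hα2 : α ≤ 2 := by rw [hα, div_le_iff₀ hγ0]; linarith
  have hα0 : 0 < α := by linarith
  have hαγ : α * γ = 1 := by rw [hα]; field_simp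
  have hpi := Real.pi_pos
  -- The midpoint of `π γ / 2` and `π / 2`, so that `cos θ > 0` and `cos (α θ) < 0` hold together.
  obtain ⟨θ, hθ⟩ : ∃ θ, θ = Real.pi * (γ + 1) / 4 := ⟨_, rfl⟩
  have hθ0 : 0 ≤ θ := by rw [hθ]; positivity
  have hθ2 : θ < Real.pi / 2 := by rw [hθ]; nlinarith
  have hαθ : Real.pi / 2 < α * θ := by
    have : α * θ = (α * γ * Real.pi + α * Real.pi) / 4 := by rw [hθ]; ring
    rw [this, hαγ]
    nlinarith
  have hcosα := cos_neg_of_pi_div_two_lt hα1 hα2 hαθ hθ2.le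
  have hcos : 0 < Real.cos θ := Real.cos_pos_of_mem_Ioo ⟨by linarith, hθ2⟩
  have hscale : ∀ t : ℝ, 0 < t → 0 < b ^ (-α) * t := fun t ht => by positivity
  have hP : ∀ t : ℝ, 0 < t → ∀ x, stableDensity α (2 - α) (b ^ (-α) * t) x =
      sectorIntegral α 0 (b ^ (-α) * t) θ x := fun t ht x =>
    stableDensity_eq_rayIntegral hα1 hα2 (hscale t ht) hαθ hθ2.le x
  have hh : ∀ t : ℝ, 0 < t → ∀ x, 0 ≤ x → inverseStableDensity γ b x t =
      α * sectorIntegral α 0 (b ^ (-α) * t) θ x := fun t ht x hx => by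
    rw [inverseStableDensity_eq hγ hγ1 hα hb ht hx, hP t ht]
  have hg := integrable_stableCharFun hγ0 hb (cos_pi_mul_div_two_pos hγ0 hγ1)
  have hg0 : ∀ x : ℝ, 0 ≤ stableDensity γ γ b x := by
    have := hD.isProbabilityMeasure_map 1
    exact stableDensity_nonneg hg hD.charFun_one
  have hcont : ∀ t : ℝ, 0 < t → ContinuousOn (fun x => inverseStableDensity γ b x t) (Ici 0) := by
    intro t ht
    have := (differentiable_sectorIntegral (β := 0) hα1 (by norm_num) (hscale t ht) hcosα).continuous
    exact (continuous_const.mul this).continuousOn.congr fun x hx => hh t ht x hx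
  have hpos : ∀ t : ℝ, 0 < t → ∀ x, 0 < x → 0 ≤ inverseStableDensity γ b x t := by
    intro t ht x hx
    rw [inverseStableDensity, if_pos hx, inverseStableFormula]
    have := hg0 (t * x ^ (-(1 / γ)))
    positivity
  have hnonneg : ∀ t : ℝ, 0 < t → ∀ x, 0 ≤ inverseStableDensity γ b x t := by
    intro t ht x
    rcases lt_trichotomy x 0 with hx | rfl | hx
    · simp [inverseStableDensity, hx.not_gt, hx.ne]
    · refine ge_of_tendsto ((hcont t ht 0 self_mem_Ici).mono_left
        (nhdsWithin_mono 0 Ioi_subset_Ici_self)) ?_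
      filter_upwards [self_mem_nhdsWithin] with y hy using hpos t ht y hy
    · exact hpos t ht x hx
  have hlaw := fun (t : ℝ) (ht : 0 < t) => hD.hasLaw_hittingTime hγ0 hγ1 hb ht
  have hmass : ∀ t : ℝ, 0 < t →
      IntegrableOn (fun x => stableDensity α (2 - α) (b ^ (-α) * t) x) (Ioi 0) ∧
      ∫ x in Ioi (0 : ℝ), stableDensity α (2 - α) (b ^ (-α) * t) x = 1 / α := by
    intro t ht
    obtain ⟨h1, h2⟩ := integral_Ioi_inverseStableDensity (hlaw t ht) (hnonneg t ht) (hcont t ht)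
    have heq : ∀ x ∈ Ioi (0 : ℝ), α⁻¹ * inverseStableDensity γ b x t =
        stableDensity α (2 - α) (b ^ (-α) * t) x := by
      intro x (hx : 0 < x)
      rw [inverseStableDensity_eq hγ hγ1 hα hb ht hx.le, inv_mul_cancel_left₀ hα0.ne']
    refine ⟨IntegrableOn.congr_fun (h1.const_mul α⁻¹) heq measurableSet_Ioi, ?_⟩
    rw [← setIntegral_congr_fun measurableSet_Ioi heq, integral_const_mul, h2, mul_one, one_div]
  have hRLh := fun (t : ℝ) (ht : 0 < t) (r : ℝ) (hr : 0 < r) =>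
    hasContNegRLDeriv_of_eqOn hα1 (hscale t ht) hcosα hθ0 hθ2 (hh t ht) hr
  have hRLP : ∀ t : ℝ, 0 < t → ∀ r : ℝ, 0 < r →
      HasContNegRLDeriv r (stableDensity α (2 - α) (b ^ (-α) * t)) ∧ ∀ x, 0 ≤ x →
        negRLDeriv r (stableDensity α (2 - α) (b ^ (-α) * t)) x =
          sectorIntegral α r (b ^ (-α) * t) θ x := by
    intro t ht r hr
    obtain ⟨h1, h2⟩ := hasContNegRLDeriv_of_eqOn
      (f := stableDensity α (2 - α) (b ^ (-α) * t)) (k := 1) hα1 (hscale t ht) hcosα hθ0 hθ2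
      (fun x _ => by rw [hP t ht, one_mul]) hr
    exact ⟨h1, fun x hx => by rw [h2 x hx, one_mul]⟩
  have hα' : 0 < α - 1 := by linarith
  refine ⟨⟨hg0, hD.stable.levy.aemeasurable 1, hD.map_one_eq hγ0 hγ1 hb⟩,
    fun t ht => ⟨hnonneg t ht, hcont t ht, hlaw t ht⟩,
    fun t ht => ⟨(hRLh t ht α hα0).1, (hRLh t ht (α - 1) hα').1⟩, ?_, ?_, ?_, ?_⟩
  · intro t ht x hx
    have hderiv : HasDerivAt (fun s => α * sectorIntegral α 0 (b ^ (-α) * s) θ x)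
        (α * (sectorIntegral α (0 + α) (b ^ (-α) * t) θ x * b ^ (-α))) t := by
      have h1 := hasDerivAt_sectorIntegral_scale (β := 0) hα1 (by norm_num) (hscale t ht) hcosα x
      have h2 : HasDerivAt (fun s => b ^ (-α) * s) (b ^ (-α)) t := by
        simpa using (hasDerivAt_id t).const_mul (b ^ (-α))
      exact (h1.comp t h2).const_mul α
    rw [(hRLh t ht α hα0).2 x hx.le]
    convert! hderiv.congr_of_eventuallyEq ?_ using 1
    · rw [zero_add]
      ring
    · filter_upwards [eventually_gt_nhds ht] with s hs using hh s hs x hx.le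
  · intro t ht
    rw [(hRLh t ht (α - 1) hα').2 0 le_rfl, sectorIntegral_sub_one_zero hα1 (hscale t ht) hcosα,
      mul_zero]
  · intro Ω' _ μ' _ Y hY t ht
    have ht' : (0 : ℝ) < t := NNReal.coe_pos.2 ht
    have hmeas := hY.levy.aemeasurable t
    have := Measure.isProbabilityMeasure_map hmeas
    have hint := integrable_stableCharFun_spectrallyNegative hα1 hα2 (hscale t ht')
    have hlawY : HasLaw (Y t) (densityMeasure (stableDensity α (2 - α) (b ^ (-α) * t))) μ' :=
      ⟨hmeas, eq_densityMeasure_stableDensity hint (hY.law t)⟩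
    refine ⟨hlawY, ?_⟩
    rw [hlawY.measureReal_eq (p := fun y => 0 < y) measurableSet_Ioi, ← (hmass t ht').2]
    change (densityMeasure _ (Ioi 0)).toReal = _
    rw [densityMeasure, withDensity_apply _ measurableSet_Ioi,
      integral_eq_lintegral_of_nonneg_ae (ae_of_all _ (stableDensity_nonneg hint (hY.law t)))
        (hmass t ht').1.aestronglyMeasurable]
  · intro t ht
    have heq : ∀ x ∈ Ioi (0 : ℝ), sectorIntegral α α (b ^ (-α) * t) θ x =
        negRLDeriv α (stableDensity α (2 - α) (b ^ (-α) * t)) x := fun x hx =>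
      ((hRLP t ht α hα0).2 x (le_of_lt hx)).symm
    have hzero : ∫ x in Ioi (0 : ℝ), negRLDeriv α (stableDensity α (2 - α) (b ^ (-α) * t)) x =
        sectorIntegral α (α - 1) (b ^ (-α) * t) θ 0 := by
      have := integral_Ioi_sectorIntegral (β := α - 1) hα1 (by linarith) (by linarith)
        (hscale t ht) hcosα hcos
      rw [sub_add_cancel] at this
      rw [← this, setIntegral_congr_fun measurableSet_Ioi heq]
    refine ⟨(hmass t ht).1, (hmass t ht).2, (hRLP t ht α hα0).1, (hRLP t ht (α - 1) hα').1,
      IntegrableOn.congr_fun (integrableOn_sectorIntegral hα1 hα0 (hscale t ht) hcosα hcos) heq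
        measurableSet_Ioi, ?_, ?_⟩
    -- The boundary value vanishes and the mass is constantly `1 / α` near `t`, so both sides are
    -- zero.
    · rw [hzero, sectorIntegral_sub_one_zero hα1 (hscale t ht) hcosα, mul_zero]
      refine (hasDerivAt_const t (1 / α)).congr_of_eventuallyEq ?_
      filter_upwards [eventually_gt_nhds ht] with s hs using (hmass s hs).2
    · rw [hzero, (hRLP t ht (α - 1) hα').2 0 le_rfl]
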